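/- Let $m>0$, let $\nu\in(-1,1)$, and let $V:\mathbb R\to\mathbb R$ be locally integrable with $$\lim_{|x|\to\infty}\int_x^{x+1}|V(t)|\,dt=0. \qquad\text{(Vcomp)}$$ In the complex Hilbert space $L^2(\mathbb R)$ let $H_V=-\frac{d^2}{dx^2}+m^2+V(x)$ on its maximal domain $$\mathcal D(H_V)=\{f\in L^2(\mathbb R):\ f,f'\in AC_{\rm loc}(\mathbb R),\ -f''+Vf\in L^2(\mathbb R)\},$$ and let $D=\frac{d}{dx}$ with $\mathrm{dom}(D)=W^{1,2}(\mathbb R)=\{f\in L^2(\mathbb R):\ f\in AC_{\rm loc}(\mathbb R),\ f'\in L^2(\mathbb R)\}$. Assume that $0\in\rho(H_V)$. In $L^2(\mathbb R)\times L^2(\mathbb R)$ consider $$\mathcal A_0=\begin{pmatrix}H_V&-\nu D\\ \nu D& I\end{pmatrix},$$ and put $S(0)=I+\nu^2DH_V^{-1}D$ (all sums and products of operators are taken on their natural domains). Then: 1. $\mathrm{dom}(\mathcal A_0)=\mathcal D(H_V)\times W^{1,2}(\mathbb R)$, and $\mathcal A_0$ is essentially self-adjoint. 2. $DH_V^{-1}$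 is defined on all of $L^2(\mathbb R)$; $H_V^{-1}D$ and $S(0)$ have domain $W^{1,2}(\mathbb R)$ and are closable, and their closures are defined on all of $L^2(\mathbb R)$. The closure $\mathcal A$ of $\mathcal A_0$ is given by $$\mathcal A=\begin{pmatrix}I&0\\ \nu DH_V^{-1}&I\end{pmatrix}\begin{pmatrix}H_V&0\\0&\overline{S(0)}\end{pmatrix}\begin{pmatrix}I&-\nu\overline{H_V^{-1}D}\\0&I\end{pmatrix}$$ on the domain $$\mathrm{dom}(\mathcal A)=\{f=(f_1,f_2)^T:\ f_1-\nu\overline{H_V^{-1}D}f_2\in\mathcal D(H_V),\ f_2\in L^2(\mathbb R)\}.$$ 3. $\mathcal A$ is bounded from below, and its form domain $\mathrm{dom}(\mathcal A^{1/2})$, that is, the domain of the closure of the quadratic form $f\mapsto\langle\mathcal Af,f\rangle$, $f\in\mathrm{dom}(\mathcal A)$, is $$\{f=(f_1,f_2)^T:\ f_1\in W^{1,2}(\mathbb R),\ f_2\in L^2(\mathbb R)\}.$$ -/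

import Mathlib

open MeasureTheory Filter Topology

noncomputable section

namespace BlockOp

/-! ### Generalities on unbounded operators -/

section Operators

variable {E F G : Type*} [NormedAddCommGroup E] [InnerProductSpace ℂ E]
  [NormedAddCommGroup F] [InnerProductSpace ℂ F] [NormedAddCommGroup G] [InnerProductSpace ℂ G]

/-- The composition `g f` of unbounded operators on its natural domain
`{x ∈ dom f : f x ∈ dom g}`. -/
def pcomp (g : F →ₗ.[ℂ] G) (f : E →ₗ.[ℂ] F) : E →ₗ.[ℂ] G where
  domain :=
    { carrier := {x | ∃ h : x ∈ f.domain, f ⟨x, h⟩ ∈ g.domain}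
      add_mem' := by
        rintro a b ⟨ha, ha'⟩ ⟨hb, hb'⟩
        refine ⟨add_mem ha hb, ?_⟩
        have : f ⟨a + b, add_mem ha hb⟩ = f ⟨a, ha⟩ + f ⟨b, hb⟩ := f.map_add ⟨a, ha⟩ ⟨b, hb⟩
        rw [this]
        exact add_mem ha' hb'
      zero_mem' := by
        refine ⟨zero_mem _, ?_⟩
        have : f ⟨0, zero_mem _⟩ = 0 := f.map_zero
        rw [this]
        exact zero_mem _
      smul_mem' := by
        rintro c a ⟨ha, ha'⟩
        refine ⟨Submodule.smul_mem _ c ha, ?_⟩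
        have : f ⟨c • a, Submodule.smul_mem _ c ha⟩ = c • f ⟨a, ha⟩ := f.map_smul c ⟨a, ha⟩
        rw [this]
        exact Submodule.smul_mem _ c ha' }
  toFun :=
    { toFun := fun x => g ⟨f ⟨x, x.2.choose⟩, x.2.choose_spec⟩
      map_add' := by
        intro x y
        rw [← g.map_add]
        congr 1
        exact Subtype.ext (f.map_add ⟨x, x.2.choose⟩ ⟨y, y.2.choose⟩)
      map_smul' := by
        intro c x
        rw [RingHom.id_apply, ← g.map_smul]
        congr 1
        exact Subtype.ext (f.map_smul c ⟨x, x.2.choose⟩) }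

theorem mem_graph_pcomp (g : F →ₗ.[ℂ] G) (f : E →ₗ.[ℂ] F) (x : E) (z : G) :
    (x, z) ∈ (pcomp g f).graph ↔ ∃ y, (x, y) ∈ f.graph ∧ (y, z) ∈ g.graph := by
  simp only [LinearPMap.mem_graph_iff]
  constructor
  · rintro ⟨⟨a, ha⟩, rfl, rfl⟩
    exact ⟨f ⟨a, ha.choose⟩, ⟨⟨a, ha.choose⟩, rfl, rfl⟩, ⟨⟨_, ha.choose_spec⟩, rfl, rfl⟩⟩
  · rintro ⟨y, ⟨a, rfl, rfl⟩, ⟨b, hb, rfl⟩⟩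
    have h' : f a ∈ g.domain := hb ▸ b.2
    refine ⟨⟨a, a.2, h'⟩, rfl, ?_⟩
    change g ⟨f a, _⟩ = g b
    congr 1
    exact Subtype.ext hb.symm

/-- The identity operator, defined everywhere. -/
def one (E : Type*) [NormedAddCommGroup E] [InnerProductSpace ℂ E] : E →ₗ.[ℂ] E :=
  (LinearMap.id : E →ₗ[ℂ] E).toPMap ⊤

/-- The operator of the block matrix with rows `(A, B)` and `(C, D)` in the Hilbert space `E × E`
(with the `ℓ²` norm), i.e. `(f₁, f₂) ↦ (A f₁ + B f₂, C f₁ + D f₂)`, on its natural domain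
`(dom A ∩ dom C) × (dom B ∩ dom D)`. -/
def block (A B C D : E →ₗ.[ℂ] E) : WithLp 2 (E × E) →ₗ.[ℂ] WithLp 2 (E × E) where
  domain := ((A.domain ⊓ C.domain).prod (B.domain ⊓ D.domain)).comap
    (WithLp.linearEquiv 2 ℂ (E × E)).toLinearMap
  toFun :=
    { toFun := fun f => WithLp.toLp 2
        (A ⟨f.1.fst, f.2.1.1⟩ + B ⟨f.1.snd, f.2.2.1⟩, C ⟨f.1.fst, f.2.1.2⟩ + D ⟨f.1.snd, f.2.2.2⟩)
      map_add' := by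
        intro f g
        have hA := A.map_add ⟨f.1.fst, f.2.1.1⟩ ⟨g.1.fst, g.2.1.1⟩
        have hB := B.map_add ⟨f.1.snd, f.2.2.1⟩ ⟨g.1.snd, g.2.2.1⟩
        have hC := C.map_add ⟨f.1.fst, f.2.1.2⟩ ⟨g.1.fst, g.2.1.2⟩
        have hD := D.map_add ⟨f.1.snd, f.2.2.2⟩ ⟨g.1.snd, g.2.2.2⟩
        rw [← WithLp.toLp_add]
        congr 1
        refine Prod.ext ?_ ?_
        · exact (congrArg₂ (· + ·) hA hB).trans (add_add_add_comm _ _ _ _)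
        · exact (congrArg₂ (· + ·) hC hD).trans (add_add_add_comm _ _ _ _)
      map_smul' := by
        intro c f
        have hA := A.map_smul c ⟨f.1.fst, f.2.1.1⟩
        have hB := B.map_smul c ⟨f.1.snd, f.2.2.1⟩
        have hC := C.map_smul c ⟨f.1.fst, f.2.1.2⟩
        have hD := D.map_smul c ⟨f.1.snd, f.2.2.2⟩
        rw [RingHom.id_apply, ← WithLp.toLp_smul]
        congr 1
        refine Prod.ext ?_ ?_
        · exact (congrArg₂ (· + ·) hA hB).trans (smul_add _ _ _).symm
        · exact (congrArg₂ (· + ·) hC hD).trans (smul_add _ _ _).symm }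

/-- `z ∈ ρ(T)`: the operator `T - z : dom T → E` is bijective with bounded inverse `R`. -/
def MemResolventSet (T : E →ₗ.[ℂ] E) (z : ℂ) : Prop :=
  ∃ R : E →L[ℂ] E,
    (∀ u : E, ∃ h : R u ∈ T.domain, T ⟨R u, h⟩ - z • R u = u) ∧
    ∀ x : T.domain, R (T x - z • (x : E)) = x

/-- `T` is essentially self-adjoint: it is closable and its closure is self-adjoint. -/
def EssentiallySelfAdjoint [CompleteSpace E] (T : E →ₗ.[ℂ] E) : Prop :=
  T.IsClosable ∧ IsSelfAdjoint T.closure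

/-- `T` is bounded from below: `⟨T x, x⟩ ≥ c ‖x‖²` on `dom T` for some real `c`. -/
def BoundedBelow (T : E →ₗ.[ℂ] E) : Prop :=
  ∃ c : ℝ, ∀ x : T.domain, c * ‖(x : E)‖ ^ 2 ≤ (inner ℂ (x : E) (T x)).re

/-- The form domain of a self-adjoint operator `T` that is bounded from below: the domain of the
closure of the quadratic form `t[x] = ⟨T x, x⟩`, `x ∈ dom T`. That is, the set of all limits in `E`
of sequences `xₙ ∈ dom T` with `t[xₙ - xₖ] → 0` as `n, k → ∞`. -/
def formDomain (T : E →ₗ.[ℂ] E) : Set E :=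
  {u | ∃ x : ℕ → T.domain, Tendsto (fun n => (x n : E)) atTop (𝓝 u) ∧
    Tendsto (fun p : ℕ × ℕ => inner ℂ ((x p.1 - x p.2 : T.domain) : E) (T (x p.1 - x p.2)))
      atTop (𝓝 0)}

end Operators

/-! ### Differential operators in `L²(ℝ)` -/

/-- The complex Hilbert space `L²(ℝ)`. -/
abbrev L2 : Type := Lp ℂ 2 (volume : Measure ℝ)

/-- `f ∈ AC_loc(ℝ)`. -/
def ACLoc (f : ℝ → ℂ) : Prop := ∀ a b : ℝ, AbsolutelyContinuousOnInterval f a b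

theorem ACLoc.add {f g : ℝ → ℂ} (hf : ACLoc f) (hg : ACLoc g) : ACLoc (f + g) :=
  fun a b => (hf a b).add (hg a b)

theorem ACLoc.const_smul {f : ℝ → ℂ} (c : ℂ) (hf : ACLoc f) : ACLoc (c • f) :=
  fun a b => (hf a b).const_smul c

theorem ACLoc.zero : ACLoc 0 := fun _ _ =>
  (LipschitzWith.const (0 : ℂ)).lipschitzOnWith.absolutelyContinuousOnInterval

theorem ACLoc.continuous {f : ℝ → ℂ} (hf : ACLoc f) : Continuous f := by
  rw [continuous_iff_continuousAt]
  intro x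
  refine (hf (x - 1) (x + 1)).continuousOn.continuousAt ?_
  rw [Set.uIcc_of_le (by linarith)]
  exact Icc_mem_nhds (by linarith) (by linarith)

theorem ACLoc.ae_differentiableAt {f : ℝ → ℂ} (hf : ACLoc f) :
    ∀ᵐ x, DifferentiableAt ℝ f x := by
  have h : ∀ n : ℕ, ∀ᵐ x : ℝ, x ∈ Set.uIcc (-(n : ℝ)) n → DifferentiableAt ℝ f x := fun n =>
    (hf (-(n : ℝ)) n).boundedVariationOn.ae_differentiableAt_of_mem_uIcc
  filter_upwards [ae_all_iff.2 h] with x hx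
  obtain ⟨n, hn⟩ := exists_nat_ge |x|
  refine hx n ?_
  rw [Set.uIcc_of_le (by linarith [abs_nonneg x])]
  exact abs_le.1 hn

/-- The graph of `D = d/dx`: the pairs `(u, w)` in `L²(ℝ) × L²(ℝ)` such that `u` has a locally
absolutely continuous representative `f` with `f' = w` almost everywhere. -/
def derivGraph : Submodule ℂ (L2 × L2) where
  carrier := {p | ∃ f : ℝ → ℂ, ACLoc f ∧ p.1 =ᵐ[volume] f ∧ p.2 =ᵐ[volume] deriv f}
  add_mem' := by
    rintro ⟨u, w⟩ ⟨u', w'⟩ ⟨f, hf, hu, hw⟩ ⟨f', hf', hu', hw'⟩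
    refine ⟨f + f', hf.add hf', (Lp.coeFn_add u u').trans (hu.add hu'), ?_⟩
    filter_upwards [Lp.coeFn_add w w', hw, hw', hf.ae_differentiableAt, hf'.ae_differentiableAt]
      with x h1 h2 h3 h4 h5
    rw [deriv_add h4 h5, ← h2, ← h3]
    exact h1
  zero_mem' := by
    refine ⟨0, ACLoc.zero, Lp.coeFn_zero _ _ _, ?_⟩
    filter_upwards [Lp.coeFn_zero ℂ 2 (volume : Measure ℝ)] with x hx
    simpa using hx
  smul_mem' := by
    rintro c ⟨u, w⟩ ⟨f, hf, hu, hw⟩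
    refine ⟨c • f, hf.const_smul c, (Lp.coeFn_smul c u).trans (hu.const_smul c), ?_⟩
    filter_upwards [Lp.coeFn_smul c w, hw, hf.ae_differentiableAt] with x h1 h2 h3
    rw [deriv_const_smul c h3, ← h2]
    exact h1

/-- `D = d/dx` in `L²(ℝ)`, with domain `W^{1,2}(ℝ)`. -/
def D : L2 →ₗ.[ℂ] L2 := derivGraph.toLinearPMap

/-- The Sobolev space
`W^{1,2}(ℝ) = {f ∈ L²(ℝ) : f ∈ AC_loc(ℝ), f' ∈ L²(ℝ)}`, the domain of `D`. -/
def W12 : Submodule ℂ L2 := D.domain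

theorem D_graph : D.graph = derivGraph := by
  refine Submodule.toLinearPMap_graph_eq _ ?_
  rintro ⟨u, w⟩ ⟨f, hf, hu, hw⟩ (rfl : u = 0)
  have h0 : f = 0 := by
    refine (hf.continuous.ae_eq_iff_eq volume continuous_zero).1 ?_
    exact hu.symm.trans (Lp.coeFn_zero _ _ _)
  refine Lp.ext (hw.trans ?_)
  subst h0
  filter_upwards [Lp.coeFn_zero ℂ 2 (volume : Measure ℝ)] with x hx
  simpa using hx.symm

theorem mem_W12_iff (u : L2) : u ∈ W12 ↔
    ∃ f : ℝ → ℂ, ACLoc f ∧ u =ᵐ[volume] f ∧ MemLp (deriv f) 2 volume := by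
  rw [W12, LinearPMap.mem_domain_iff, D_graph]
  constructor
  · rintro ⟨w, f, hf, hu, hw⟩
    exact ⟨f, hf, hu, (memLp_congr_ae hw).1 (Lp.memLp w)⟩
  · rintro ⟨f, hf, hu, hw⟩
    exact ⟨hw.toLp, f, hf, hu, hw.coeFn_toLp⟩

/-- The differential expression `-f'' + m² f + V f`. -/
def schrodingerExpr (m : ℝ) (V : ℝ → ℝ) (f : ℝ → ℂ) (x : ℝ) : ℂ :=
  -deriv (deriv f) x + (m : ℂ) ^ 2 * f x + (V x : ℂ) * f x

/-- The graph of the maximal operator of `-d²/dx² + m² + V(x)` in `L²(ℝ)`: the pairs `(u, w)` such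
that `u` has a representative `f` with `f, f' ∈ AC_loc(ℝ)` and `-f'' + m² f + V f = w`. -/
def schrodingerGraph (m : ℝ) (V : ℝ → ℝ) : Submodule ℂ (L2 × L2) where
  carrier := {p | ∃ f : ℝ → ℂ, ACLoc f ∧ Differentiable ℝ f ∧ ACLoc (deriv f) ∧
    p.1 =ᵐ[volume] f ∧ p.2 =ᵐ[volume] schrodingerExpr m V f}
  add_mem' := by
    rintro ⟨u, w⟩ ⟨u', w'⟩ ⟨f, hf, hd, hf1, hu, hw⟩ ⟨g, hg, he, hg1, hu', hw'⟩
    have hderiv : deriv (f + g) = deriv f + deriv g := by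
      funext x
      exact deriv_add (hd x) (he x)
    refine ⟨f + g, hf.add hg, hd.add he, hderiv ▸ hf1.add hg1,
      (Lp.coeFn_add u u').trans (hu.add hu'), ?_⟩
    filter_upwards [Lp.coeFn_add w w', hw, hw', hf1.ae_differentiableAt, hg1.ae_differentiableAt]
      with x h1 h2 h3 h4 h5
    refine h1.trans ?_
    rw [Pi.add_apply, h2, h3]
    simp only [schrodingerExpr, hderiv, deriv_add h4 h5, Pi.add_apply]
    ring
  zero_mem' := by
    have hderiv : deriv (0 : ℝ → ℂ) = 0 := by
      funext x
      simp
    refine ⟨0, ACLoc.zero, differentiable_const 0, (by rw [hderiv]; exact ACLoc.zero),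
      Lp.coeFn_zero _ _ _, ?_⟩
    filter_upwards [Lp.coeFn_zero ℂ 2 (volume : Measure ℝ)] with x hx
    simpa [schrodingerExpr, hderiv] using hx
  smul_mem' := by
    rintro c ⟨u, w⟩ ⟨f, hf, hd, hf1, hu, hw⟩
    have hderiv : deriv (c • f) = c • deriv f := by
      funext x
      exact deriv_const_smul c (hd x)
    refine ⟨c • f, hf.const_smul c, hd.const_smul c, hderiv ▸ hf1.const_smul c,
      (Lp.coeFn_smul c u).trans (hu.const_smul c), ?_⟩
    filter_upwards [Lp.coeFn_smul c w, hw, hf1.ae_differentiableAt] with x h1 h2 h3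
    refine h1.trans ?_
    rw [Pi.smul_apply, h2]
    simp only [schrodingerExpr, hderiv, deriv_const_smul c h3, Pi.smul_apply, smul_eq_mul]
    ring

/-- The Schrödinger operator `H_V = -d²/dx² + m² + V(x)` in `L²(ℝ)` on its maximal domain. -/
def H (m : ℝ) (V : ℝ → ℝ) : L2 →ₗ.[ℂ] L2 := (schrodingerGraph m V).toLinearPMap

theorem H_graph (m : ℝ) (V : ℝ → ℝ) : (H m V).graph = schrodingerGraph m V := by
  refine Submodule.toLinearPMap_graph_eq _ ?_
  rintro ⟨u, w⟩ ⟨f, hf, hd, hf1, hu, hw⟩ (rfl : u = 0)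
  have h0 : f = 0 := by
    refine (hf.continuous.ae_eq_iff_eq volume continuous_zero).1 ?_
    exact hu.symm.trans (Lp.coeFn_zero _ _ _)
  refine Lp.ext (hw.trans ?_)
  subst h0
  have hderiv : deriv (0 : ℝ → ℂ) = 0 := by
    funext x
    simp
  filter_upwards [Lp.coeFn_zero ℂ 2 (volume : Measure ℝ)] with x hx
  simpa [schrodingerExpr, hderiv] using hx.symm

/-- The Hilbert space `L²(ℝ) × L²(ℝ)`. -/
abbrev L2xL2 : Type := WithLp 2 (L2 × L2)

/-- `𝒜₀`, the block matrix with rows `(H_V, -ν D)` and `(ν D, I)`. -/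
def A0 (m ν : ℝ) (V : ℝ → ℝ) : L2xL2 →ₗ.[ℂ] L2xL2 :=
  block (H m V) (-((ν : ℂ) • D)) ((ν : ℂ) • D) (one L2)

/-- `D H_V⁻¹`. -/
def DHinv (m : ℝ) (V : ℝ → ℝ) : L2 →ₗ.[ℂ] L2 := pcomp D (H m V).inverse

/-- `H_V⁻¹ D`. -/
def HinvD (m : ℝ) (V : ℝ → ℝ) : L2 →ₗ.[ℂ] L2 := pcomp (H m V).inverse D

/-- `S(0) = I - (ν D) H_V⁻¹ (-ν D)`. -/
def S0 (m ν : ℝ) (V : ℝ → ℝ) : L2 →ₗ.[ℂ] L2 :=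
  one L2 - pcomp ((ν : ℂ) • D) (pcomp (H m V).inverse (-((ν : ℂ) • D)))

end BlockOp

end

namespace BlockOp

/-! ### Calculus of locally absolutely continuous functions -/

/-! Write `R` for the inverse of `H_V`. The hypothesis on `V` bounds the integrals of `|V|` over
unit intervals uniformly. With the one-dimensional Sobolev inequality on short intervals, this makes
`V` form-bounded with relative bound zero (`exists_form_bound`). Hence functions in the maximal
domain have square-integrable derivative (`memLp_deriv_of_schrodinger`), and `H_V` is represented on
`W^{1,2}` by the form `⟨v', u'⟩ + m² ⟨v, u⟩ + ∫ V conj(v) u` (`H_form`). It follows that `R` is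
symmetric, that `A = D R` is everywhere defined and bounded by the closed graph theorem, and that `B
= -A^*` extends `R D`. For `p = D u` skewness gives `⟨R p, p⟩ = -⟨A p, u⟩`. Inserted into the lower
bound of the form, this shows that `D R D` is bounded in the `L²` norm, with a symmetric extension
`G` (`exists_G`, `G_symm`). The closure of `S(0)` is therefore `I + ν² G`.

In the mixed coordinates `(g₁, f₂)` everything is now bounded. The equations `f₁ = R g₁ + ν B f₂`
and `g₂ = ν A g₁ + f₂ + ν² G f₂` define a closed graph. The graph of `𝒜₀` is its part with `f₂ ∈
W^{1,2}`, which is dense in it, and the same equations describe the Frobenius-Schur product.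
Self-adjointness reduces to the symmetry of `R` and `G` and to `B = -A^*`.

For `f₁ = R w` the form of `𝒜₀` equals `⟨R w, w⟩ + 2ν Re⟨f₁', f₂⟩ + ‖f₂‖²`. Since `|ν| < 1`, the
cross term is absorbed, so up to a multiple of `‖f₁‖²` the form controls `‖f₁'‖²`. It is also
bounded by the norm of `W^{1,2} × L²`. A Lax-Milgram argument shows that the domain of `H_V` is
dense in `W^{1,2}`, which identifies the form domain. -/

theorem ACLoc.clm_comp {f : ℝ → ℂ} (hf : ACLoc f) {F : Type*} [NormedAddCommGroup F]
    [NormedSpace ℝ F] (L : ℂ →L[ℝ] F) (a b : ℝ) :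
    AbsolutelyContinuousOnInterval (fun x => L (f x)) a b := by
  have h0 := Tendsto.const_mul ‖L‖ (hf a b)
  rw [mul_zero] at h0
  refine squeeze_zero (fun t => Finset.sum_nonneg fun i _ => dist_nonneg) (fun t => ?_) h0
  rw [Finset.mul_sum]
  refine Finset.sum_le_sum fun i _ => ?_
  rw [dist_eq_norm, dist_eq_norm, ← map_sub]
  exact L.le_opNorm _

theorem ACLoc.conj {f : ℝ → ℂ} (hf : ACLoc f) : ACLoc (fun x => starRingEnd ℂ (f x)) :=
  fun a b => hf.clm_comp (Complex.conjCLE : ℂ →L[ℝ] ℂ) a b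

theorem ACLoc.mul {f g : ℝ → ℂ} (hf : ACLoc f) (hg : ACLoc g) : ACLoc (fun x => f x * g x) :=
  fun a b => (hf a b).fun_smul (hg a b)

/-- The real and imaginary parts are real-valued and absolutely continuous, and almost everywhere
their derivatives recombine to the complex derivative. -/
theorem ACLoc.intervalIntegrable_deriv {f : ℝ → ℂ} (hf : ACLoc f) (a b : ℝ) :
    IntervalIntegrable (deriv f) volume a b := by
  have h1 := (hf.clm_comp Complex.reCLM a b).intervalIntegrable_deriv
  have h2 := (hf.clm_comp Complex.imCLM a b).intervalIntegrable_deriv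
  have h1' : IntervalIntegrable (fun x => ((deriv (fun x => Complex.reCLM (f x)) x : ℝ) : ℂ))
      volume a b := ⟨h1.1.ofReal, h1.2.ofReal⟩
  have h2' : IntervalIntegrable (fun x => ((deriv (fun x => Complex.imCLM (f x)) x : ℝ) : ℂ))
      volume a b := ⟨h2.1.ofReal, h2.2.ofReal⟩
  have h3 := h1'.add (h2'.mul_const Complex.I)
  refine h3.congr_ae (ae_restrict_of_ae ?_)
  filter_upwards [hf.ae_differentiableAt] with x hx
  have e1 : HasDerivAt (fun x => Complex.reCLM (f x)) (Complex.reCLM (deriv f x)) x :=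
    Complex.reCLM.hasFDerivAt.comp_hasDerivAt x hx.hasDerivAt
  have e2 : HasDerivAt (fun x => Complex.imCLM (f x)) (Complex.imCLM (deriv f x)) x :=
    Complex.imCLM.hasFDerivAt.comp_hasDerivAt x hx.hasDerivAt
  simp only [e1.deriv, e2.deriv]
  exact Complex.re_add_im _

theorem ACLoc.integral_deriv {f : ℝ → ℂ} (hf : ACLoc f) (a b : ℝ) :
    ∫ x in a..b, deriv f x = f b - f a := by
  have hi := hf.intervalIntegrable_deriv a b
  have key : ∀ L : ℂ →L[ℝ] ℝ, L (∫ x in a..b, deriv f x) = L (f b - f a) := by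
    intro L
    rw [← L.intervalIntegral_comp_comm hi, map_sub,
      ← (hf.clm_comp L a b).integral_deriv_eq_sub]
    refine intervalIntegral.integral_congr_ae ?_
    filter_upwards [hf.ae_differentiableAt] with x hx _
    exact ((L.hasFDerivAt.comp_hasDerivAt x hx.hasDerivAt).deriv).symm
  exact Complex.ext (key Complex.reCLM) (key Complex.imCLM)

/-- Needed for the closedness of `D`, where the limit function is rebuilt as a primitive of the
limit of the derivatives. -/
theorem ACLoc.of_integral {g : ℝ → ℂ} (hg : LocallyIntegrable g volume) (a : ℝ) (c : ℂ) :
    ACLoc (fun x => c + ∫ t in a..x, g t) ∧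
      deriv (fun x => c + ∫ t in a..x, g t) =ᵐ[volume] g := by
  have hii : ∀ x y, IntervalIntegrable g volume x y := fun x y =>
    intervalIntegrable_iff.mpr
      ((hg.integrableOn_isCompact isCompact_uIcc).mono_set Set.uIoc_subset_uIcc)
  constructor
  · have hre : ACLoc (fun x => ((∫ t in a..x, (g t).re : ℝ) : ℂ)) := by
      intro x y
      have h0 : IntervalIntegrable (fun t => (g t).re) volume (min (min x y) a) (max (max x y) a) :=
        ⟨(hii _ _).1.re, (hii _ _).2.re⟩
      have h1 := h0.absolutelyContinuousOnInterval_intervalIntegral (c := a)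
        (by rw [Set.uIcc_of_le] <;> simp)
      have h2 := h1.mono (c := x) (d := y) (by
        rw [Set.uIcc_of_le (a := min (min x y) a) (by simp), Set.uIcc]
        exact Set.Icc_subset_Icc (min_le_left _ _) (le_max_left _ _))
      refine squeeze_zero (fun t => Finset.sum_nonneg fun i _ => dist_nonneg) (fun t => ?_) h2
      refine Finset.sum_le_sum fun i _ => ?_
      rw [dist_eq_norm, dist_eq_norm, ← Complex.ofReal_sub, Complex.norm_real]
    have him : ACLoc (fun x => ((∫ t in a..x, (g t).im : ℝ) : ℂ)) := by
      intro x y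
      have h0 : IntervalIntegrable (fun t => (g t).im) volume (min (min x y) a) (max (max x y) a) :=
        ⟨(hii _ _).1.im, (hii _ _).2.im⟩
      have h1 := h0.absolutelyContinuousOnInterval_intervalIntegral (c := a)
        (by rw [Set.uIcc_of_le] <;> simp)
      have h2 := h1.mono (c := x) (d := y) (by
        rw [Set.uIcc_of_le (a := min (min x y) a) (by simp), Set.uIcc]
        exact Set.Icc_subset_Icc (min_le_left _ _) (le_max_left _ _))
      refine squeeze_zero (fun t => Finset.sum_nonneg fun i _ => dist_nonneg) (fun t => ?_) h2
      refine Finset.sum_le_sum fun i _ => ?_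
      rw [dist_eq_norm, dist_eq_norm, ← Complex.ofReal_sub, Complex.norm_real]
    have hc : ACLoc (fun _ => c) := fun _ _ =>
      (LipschitzWith.const c).lipschitzOnWith.absolutelyContinuousOnInterval
    have := hc.add (hre.add (him.const_smul Complex.I))
    convert this using 1
    funext x
    simp only [Pi.add_apply, Pi.smul_apply, smul_eq_mul]
    congr 1
    have e1 := Complex.reCLM.intervalIntegral_comp_comm (hii a x)
    have e2 := Complex.imCLM.intervalIntegral_comp_comm (hii a x)
    simp only [Complex.reCLM_apply, Complex.imCLM_apply] at e1 e2
    rw [e1, e2, mul_comm]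
    exact (Complex.re_add_im _).symm
  · filter_upwards [_root_.LocallyIntegrable.ae_hasDerivAt_integral hg] with x hx
    exact ((hx a).const_add c).deriv

/-- A locally absolutely continuous function which is integrable together with its derivative has
a derivative of mean zero. -/
theorem ACLoc.integral_deriv_eq_zero {f : ℝ → ℂ} (hf : ACLoc f) (hi : Integrable f volume)
    (hd : Integrable (deriv f) volume) : ∫ x, deriv f x = 0 := by
  have hfx : ∀ x, f x = f 0 + ∫ t in (0 : ℝ)..x, deriv f t := fun x => by
    rw [hf.integral_deriv]; ring
  have htop : Tendsto f atTop (𝓝 (f 0 + ∫ t in Set.Ioi (0 : ℝ), deriv f t)) := by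
    have := (intervalIntegral_tendsto_integral_Ioi 0 hd.integrableOn tendsto_id).const_add (f 0)
    exact this.congr fun x => (hfx x).symm
  have hbot : Tendsto f atBot (𝓝 (f 0 - ∫ t in Set.Iic (0 : ℝ), deriv f t)) := by
    have := (intervalIntegral_tendsto_integral_Iic 0 hd.integrableOn tendsto_id).const_sub (f 0)
    refine this.congr fun x => ?_
    rw [hf.integral_deriv]; simp
  -- The limits at both ends exist because `f'` is integrable; they vanish because half-lines have
  -- infinite measure and `f` is integrable.
  have h1 : f 0 + ∫ t in Set.Ioi (0 : ℝ), deriv f t = 0 := by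
    refine IntegrableAtFilter.eq_zero_of_tendsto (hi.integrableAtFilter _) (fun s hs => ?_) htop
    obtain ⟨b, hb⟩ := mem_atTop_sets.1 hs
    rw [← top_le_iff, ← Real.volume_Ici (a := b)]
    exact measure_mono hb
  have h2 : f 0 - ∫ t in Set.Iic (0 : ℝ), deriv f t = 0 := by
    refine IntegrableAtFilter.eq_zero_of_tendsto (hi.integrableAtFilter _) (fun s hs => ?_) hbot
    obtain ⟨b, hb⟩ := mem_atBot_sets.1 hs
    rw [← top_le_iff, ← Real.volume_Iic (a := b)]
    exact measure_mono hb
  rw [← intervalIntegral.integral_Iic_add_Ioi (b := 0) hd.integrableOn hd.integrableOn]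
  linear_combination h1 - h2

theorem hasDerivAt_conj {f : ℝ → ℂ} {x : ℝ} (hf : DifferentiableAt ℝ f x) :
    HasDerivAt (fun x => starRingEnd ℂ (f x)) (starRingEnd ℂ (deriv f x)) x :=
  (Complex.conjCLE : ℂ →L[ℝ] ℂ).hasFDerivAt.comp_hasDerivAt x hf.hasDerivAt

theorem ACLoc.deriv_conj_mul {f g : ℝ → ℂ} (hf : ACLoc f) (hg : ACLoc g) :
    deriv (fun x => starRingEnd ℂ (f x) * g x) =ᵐ[volume]
      fun x => starRingEnd ℂ (deriv f x) * g x + starRingEnd ℂ (f x) * deriv g x := by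
  filter_upwards [hf.ae_differentiableAt, hg.ae_differentiableAt] with x h1 h2
  exact ((hasDerivAt_conj h1).mul h2.hasDerivAt).deriv

/-- Integration by parts on the line. -/
theorem ACLoc.integral_conj_deriv_mul {f g : ℝ → ℂ} (hf : ACLoc f) (hg : ACLoc g)
    (h0 : Integrable (fun x => starRingEnd ℂ (f x) * g x) volume)
    (h1 : Integrable (fun x => starRingEnd ℂ (deriv f x) * g x) volume)
    (h2 : Integrable (fun x => starRingEnd ℂ (f x) * deriv g x) volume) :
    ∫ x, starRingEnd ℂ (deriv f x) * g x = -∫ x, starRingEnd ℂ (f x) * deriv g x := by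
  have hd := hf.deriv_conj_mul hg
  have := (hf.conj.mul hg).integral_deriv_eq_zero h0 ((h1.add h2).congr hd.symm)
  rw [integral_congr_ae hd, integral_add h1 h2] at this
  exact eq_neg_of_add_eq_zero_left this

/-- Integration by parts on an interval. -/
theorem ACLoc.intervalIntegral_conj_deriv_mul_self {f : ℝ → ℂ} (hf : ACLoc f)
    (hf1 : ACLoc (deriv f)) (a b : ℝ) :
    ∫ x in a..b, (starRingEnd ℂ (deriv f x) * deriv f x + starRingEnd ℂ (f x) * deriv (deriv f) x) =
      starRingEnd ℂ (f b) * deriv f b - starRingEnd ℂ (f a) * deriv f a := by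
  rw [← (hf.conj.mul hf1).integral_deriv a b]
  refine intervalIntegral.integral_congr_ae ?_
  filter_upwards [hf.deriv_conj_mul hf1] with x hx _
  exact hx.symm

/-! ### Inner products in `L²`; skewness, closedness and density of the domain of `D` -/

theorem L2.inner_def (u v : L2) : inner ℂ u v = ∫ x, starRingEnd ℂ (u x) * v x := by
  rw [MeasureTheory.L2.inner_def]
  refine integral_congr_ae (ae_of_all _ fun x => ?_)
  simp [mul_comm]

theorem integrable_conj_mul {f g : ℝ → ℂ} (hf : MemLp f 2 volume) (hg : MemLp g 2 volume) :
    Integrable (fun x => starRingEnd ℂ (f x) * g x) volume := by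
  have : MemLp (fun x => starRingEnd ℂ (f x)) 2 volume := hf.star
  exact this.integrable_mul hg

theorem L2.norm_sq (u : L2) : ‖u‖ ^ 2 = ∫ x, ‖u x‖ ^ 2 := by
  have h := inner_self_eq_norm_sq_to_K (𝕜 := ℂ) u
  rw [L2.inner_def] at h
  have h2 : ∀ x, starRingEnd ℂ (u x) * u x = ((‖u x‖ ^ 2 : ℝ) : ℂ) := fun x => by
    rw [Complex.conj_mul']; push_cast; rfl
  simp_rw [h2] at h
  have h3 : ∫ x, ((‖u x‖ ^ 2 : ℝ) : ℂ) = ((∫ x, ‖u x‖ ^ 2 : ℝ) : ℂ) := integral_ofReal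
  rw [h3] at h
  refine Complex.ofReal_injective ?_
  rw [Complex.ofReal_pow]
  exact h.symm

/-- `D` is skew-symmetric. -/
theorem D_skew {u p v q : L2} (hu : (u, p) ∈ D.graph) (hv : (v, q) ∈ D.graph) :
    inner ℂ p v = -inner ℂ u q := by
  rw [D_graph] at hu hv
  obtain ⟨f, hf, huf, hpf⟩ := hu
  obtain ⟨g, hg, hvg, hqg⟩ := hv
  simp only at huf hpf hvg hqg
  have mu := (memLp_congr_ae huf).1 (Lp.memLp u)
  have mp := (memLp_congr_ae hpf).1 (Lp.memLp p)
  have mv := (memLp_congr_ae hvg).1 (Lp.memLp v)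
  have mq := (memLp_congr_ae hqg).1 (Lp.memLp q)
  have := hf.integral_conj_deriv_mul hg (integrable_conj_mul mu mv) (integrable_conj_mul mp mv)
    (integrable_conj_mul mu mq)
  rw [L2.inner_def, L2.inner_def]
  have e1 : ∫ x, starRingEnd ℂ (p x) * v x = ∫ x, starRingEnd ℂ (deriv f x) * g x := by
    refine integral_congr_ae ?_
    filter_upwards [hpf, hvg] with x h1 h2
    rw [h1, h2]
  have e2 : ∫ x, starRingEnd ℂ (u x) * q x = ∫ x, starRingEnd ℂ (f x) * deriv g x := by
    refine integral_congr_ae ?_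
    filter_upwards [huf, hqg] with x h1 h2
    rw [h1, h2]
  rw [e1, e2, this]

/-- `D` is closed. -/
theorem D_isClosed : IsClosed (D.graph : Set (L2 × L2)) := by
  rw [D_graph]
  refine IsSeqClosed.isClosed fun s p hs hp => ?_
  obtain ⟨u, w⟩ := p
  have hu : Tendsto (fun n => (s n).1) atTop (𝓝 u) := (continuous_fst.tendsto _).comp hp
  have hw : Tendsto (fun n => (s n).2) atTop (𝓝 w) := (continuous_snd.tendsto _).comp hp
  choose f hf huf hwf using hs
  obtain ⟨ns, hns, hae⟩ := (tendstoInMeasure_of_tendsto_Lp hu).exists_seq_tendsto_ae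
  have hae' : ∀ᵐ x, Tendsto (fun i => f (ns i) x) atTop (𝓝 (u x)) := by
    filter_upwards [hae, ae_all_iff.2 huf] with x h1 h2
    exact h1.congr fun i => h2 _
  -- A single point of convergence of the representatives fixes the constant of integration of the
  -- limit.
  obtain ⟨a, ha⟩ := hae'.exists
  have hwloc : LocallyIntegrable w volume := (Lp.memLp w).locallyIntegrable (by norm_num)
  obtain ⟨hac, hder⟩ := ACLoc.of_integral hwloc a (u a)
  -- Integration over a bounded interval is the pairing with an indicator function, hence continuous
  -- in `L²`.
  have hint : ∀ x, Tendsto (fun n => ∫ t in a..x, (s n).2 t) atTop (𝓝 (∫ t in a..x, w t)) := by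
    intro x
    have key : ∀ y z : ℝ, Tendsto (fun n => ∫ t in Set.Ioc y z, (s n).2 t) atTop
        (𝓝 (∫ t in Set.Ioc y z, w t)) := by
      intro y z
      have hm : MeasurableSet (Set.Ioc y z) := measurableSet_Ioc
      have hfin : volume (Set.Ioc y z) ≠ ⊤ := by simp
      simp_rw [← L2.inner_indicatorConstLp_one (𝕜 := ℂ) hm hfin]
      exact tendsto_const_nhds.inner hw
    exact (key a x).sub (key x a)
  refine ⟨_, hac, ?_, hder.symm⟩
  filter_upwards [hae'] with x hx
  refine tendsto_nhds_unique hx ?_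
  have h3 : Tendsto (fun i => f (ns i) a + ∫ t in a..x, (s (ns i)).2 t) atTop
      (𝓝 (u a + ∫ t in a..x, w t)) := ha.add ((hint x).comp hns.tendsto_atTop)
  refine h3.congr fun i => ?_
  rw [intervalIntegral.integral_congr_ae (g := deriv (f (ns i)))
    ((hwf (ns i)).mono fun x hx _ => hx), (hf _).integral_deriv]
  ring

/-- `W^{1,2}(ℝ)` is dense in `L²(ℝ)`. -/
theorem dense_W12 : Dense (D.domain : Set L2) := by
  refine (SchwartzMap.denseRange_toLpCLM (E := ℝ) (F := ℂ) (μ := volume) (p := 2)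
    (by norm_num)).mono ?_
  rintro _ ⟨φ, rfl⟩
  refine (mem_W12_iff _).2 ⟨φ, fun a b => ?_, SchwartzMap.coeFn_toLp φ 2 volume, ?_⟩
  · exact (φ.smooth 1).contDiffOn.absolutelyContinuousOnInterval
  · exact (SchwartzMap.derivCLM ℝ ℂ φ).memLp 2 volume

/-! ### Form-boundedness of uniformly locally integrable potentials -/

theorem intervalIntegrable_abs {V : ℝ → ℝ} (hV : LocallyIntegrable V volume) (a b : ℝ) :
    IntervalIntegrable (fun x => |V x|) volume a b :=
  (intervalIntegrable_iff.mpr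
    ((hV.integrableOn_isCompact isCompact_uIcc).mono_set Set.uIoc_subset_uIcc)).abs

/-- Outside a compact set the integral is below one by the decay hypothesis; on the compact set it
is bounded because it depends continuously on `x`. -/
theorem exists_unif_bound {V : ℝ → ℝ} (hV : LocallyIntegrable V volume)
    (hVcomp : Tendsto (fun x : ℝ => ∫ t in x..(x + 1), |V t|) (cocompact ℝ) (𝓝 0)) :
    ∃ M : ℝ, 0 ≤ M ∧ ∀ x, ∫ t in x..(x + 1), |V t| ≤ M := by
  have hcont : Continuous fun x : ℝ => ∫ t in x..(x + 1), |V t| := by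
    have hc := intervalIntegral.continuous_primitive (intervalIntegrable_abs hV) 0
    have : (fun x : ℝ => ∫ t in x..(x + 1), |V t|) =
        fun x => (∫ t in (0 : ℝ)..(x + 1), |V t|) - ∫ t in (0 : ℝ)..x, |V t| := by
      funext x
      rw [intervalIntegral.integral_interval_sub_left] <;> exact intervalIntegrable_abs hV _ _
    rw [this]
    exact (hc.comp (continuous_id.add continuous_const)).sub hc
  obtain ⟨K, hK, hK1⟩ := mem_cocompact.1 (hVcomp.eventually (gt_mem_nhds (zero_lt_one' ℝ)))
  obtain ⟨M, hM⟩ := hK.exists_bound_of_continuousOn hcont.continuousOn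
  refine ⟨max M 1, le_max_of_le_right zero_le_one, fun x => ?_⟩
  by_cases hx : x ∈ K
  · exact (le_abs_self _).trans ((hM x hx).trans (le_max_left _ _))
  · exact (le_of_lt (hK1 hx)).trans (le_max_right _ _)

/-- The Cauchy-Schwarz inequality against the constant one, obtained from the nonnegativity of the
variance of `h` about its mean `k`. -/
theorem sq_intervalIntegral_le {h : ℝ → ℝ} {a b : ℝ} (hab : a < b)
    (h1 : IntervalIntegrable h volume a b) (h2 : IntervalIntegrable (fun x => h x ^ 2) volume a b) :
    (∫ x in a..b, h x) ^ 2 ≤ (b - a) * ∫ x in a..b, h x ^ 2 := by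
  have hd : 0 < b - a := sub_pos.2 hab
  set k := (∫ x in a..b, h x) / (b - a) with hk
  have e : ∫ x in a..b, (h x - k) ^ 2 =
      (∫ x in a..b, h x ^ 2) - 2 * k * (∫ x in a..b, h x) + (b - a) * k ^ 2 := by
    rw [show (fun x => (h x - k) ^ 2) = fun x => h x ^ 2 - 2 * k * h x + k ^ 2 by funext x; ring]
    rw [intervalIntegral.integral_add (h2.sub (h1.const_mul _)) (by simp),
      intervalIntegral.integral_sub h2 (h1.const_mul _), intervalIntegral.integral_const_mul]
    simp
  have h0 : 0 ≤ ∫ x in a..b, (h x - k) ^ 2 :=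
    intervalIntegral.integral_nonneg hab.le fun x _ => sq_nonneg _
  rw [e] at h0
  have hI : (∫ x in a..b, h x) = k * (b - a) := by rw [hk]; field_simp
  rw [hI] at h0 ⊢
  nlinarith

/-- Write `f x` as `f y` plus the integral of `f'` from `y` to `x`, square, and average over `y`.
The length `b - a` multiplies the derivative term, so short intervals make its coefficient small. -/
theorem ACLoc.norm_sq_le {f : ℝ → ℂ} (hf : ACLoc f) {a b : ℝ} (hab : a < b)
    (h2 : IntervalIntegrable (fun x => ‖deriv f x‖ ^ 2) volume a b) {x : ℝ}
    (hx : x ∈ Set.Icc a b) :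
    ‖f x‖ ^ 2 ≤ 2 / (b - a) * (∫ t in a..b, ‖f t‖ ^ 2) +
      2 * (b - a) * ∫ t in a..b, ‖deriv f t‖ ^ 2 := by
  have hd : 0 < b - a := sub_pos.2 hab
  have h1 := (hf.intervalIntegrable_deriv a b).norm
  set I := ∫ t in a..b, ‖deriv f t‖ ^ 2
  have key : ∀ y ∈ Set.Icc a b, ‖f x‖ ^ 2 ≤ 2 * ‖f y‖ ^ 2 + 2 * (b - a) * I := by
    intro y hy
    have e := hf.integral_deriv y x
    have n1 : ‖f x - f y‖ ≤ ∫ t in a..b, ‖deriv f t‖ := by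
      rw [← e]
      refine (intervalIntegral.norm_integral_le_integral_norm_uIoc).trans ?_
      rw [intervalIntegral.integral_of_le hab.le]
      refine setIntegral_mono_set h1.1 (ae_of_all _ fun _ => norm_nonneg _) ?_
      refine LE.le.eventuallyLE ?_
      exact Set.Ioc_subset_Ioc (le_min hy.1 hx.1) (max_le hy.2 hx.2)
    have n2 := sq_intervalIntegral_le hab h1 h2
    have n3 : ‖f x‖ ≤ ‖f y‖ + ‖f x - f y‖ := by
      have := norm_add_le (f y) (f x - f y)
      simpa using this
    have n4 : ‖f x - f y‖ ^ 2 ≤ (b - a) * I := (by gcongr : _ ≤ _).trans n2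
    nlinarith [norm_nonneg (f x), norm_nonneg (f y), norm_nonneg (f x - f y),
      sq_nonneg (‖f y‖ - ‖f x - f y‖)]
  have hc : Continuous fun t => ‖f t‖ ^ 2 := hf.continuous.norm.pow 2
  have hmono : ∫ _ in a..b, ‖f x‖ ^ 2 ≤ ∫ t in a..b, (2 * ‖f t‖ ^ 2 + 2 * (b - a) * I) :=
    intervalIntegral.integral_mono_on hab.le (by simp)
      (((hc.const_mul 2).add continuous_const).intervalIntegrable _ _) key
  rw [intervalIntegral.integral_add ((hc.const_mul 2).intervalIntegrable _ _) (by simp),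
    intervalIntegral.integral_const_mul, intervalIntegral.integral_const,
    intervalIntegral.integral_const, smul_eq_mul, smul_eq_mul] at hmono
  have : ‖f x‖ ^ 2 * (b - a) ≤ (2 / (b - a) * (∫ t in a..b, ‖f t‖ ^ 2) +
      2 * (b - a) * I) * (b - a) := by
    have : 2 / (b - a) * (∫ t in a..b, ‖f t‖ ^ 2) * (b - a) = 2 * ∫ t in a..b, ‖f t‖ ^ 2 := by
      field_simp
    nlinarith
  exact le_of_mul_le_mul_right this hd

theorem intervalIntegrable_potential {V : ℝ → ℝ} (hV : LocallyIntegrable V volume) {f : ℝ → ℂ}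
    (hf : Continuous f) (a b : ℝ) :
    IntervalIntegrable (fun x => |V x| * ‖f x‖ ^ 2) volume a b :=
  (intervalIntegrable_abs hV a b).mul_continuousOn (hf.norm.pow 2).continuousOn

/-- On each of the `n` cells of length `δ` the supremum of `‖f‖²` is pulled out of the integral. The
remaining integral of `|V|` is at most `M` because `δ ≤ 1`. -/
theorem ACLoc.integral_potential_le {V : ℝ → ℝ} (hV : LocallyIntegrable V volume) {M : ℝ}
    (hM : ∀ x, ∫ t in x..(x + 1), |V t| ≤ M) {f : ℝ → ℂ} (hf : ACLoc f)
    (h2 : ∀ a b, IntervalIntegrable (fun x => ‖deriv f x‖ ^ 2) volume a b) {δ : ℝ} (hδ : 0 < δ)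
    (hδ1 : δ ≤ 1) (a : ℝ) (n : ℕ) :
    ∫ t in a..(a + n * δ), |V t| * ‖f t‖ ^ 2 ≤
      M * (2 / δ * (∫ t in a..(a + n * δ), ‖f t‖ ^ 2) +
        2 * δ * ∫ t in a..(a + n * δ), ‖deriv f t‖ ^ 2) := by
  have hc : Continuous fun t => ‖f t‖ ^ 2 := hf.continuous.norm.pow 2
  induction n with
  | zero => simp
  | succ n ih =>
    set c := a + n * δ with hcdef
    have e : a + ((n + 1 : ℕ) : ℝ) * δ = c + δ := by rw [hcdef]; push_cast; ring
    rw [e, ← intervalIntegral.integral_add_adjacent_intervals (b := c)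
      (intervalIntegrable_potential hV hf.continuous _ _)
      (intervalIntegrable_potential hV hf.continuous _ _),
      ← intervalIntegral.integral_add_adjacent_intervals (b := c)
      (hc.intervalIntegrable _ _) (hc.intervalIntegrable _ _),
      ← intervalIntegral.integral_add_adjacent_intervals (b := c) (h2 _ _) (h2 _ _)]
    set B := 2 / δ * (∫ t in c..(c + δ), ‖f t‖ ^ 2) + 2 * δ * ∫ t in c..(c + δ), ‖deriv f t‖ ^ 2
      with hB
    have hcd : c < c + δ := by linarith
    have hB0 : 0 ≤ B := by
      have i1 : 0 ≤ ∫ t in c..(c + δ), ‖f t‖ ^ 2 :=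
        intervalIntegral.integral_nonneg hcd.le fun _ _ => by positivity
      have i2 : 0 ≤ ∫ t in c..(c + δ), ‖deriv f t‖ ^ 2 :=
        intervalIntegral.integral_nonneg hcd.le fun _ _ => by positivity
      positivity
    have step : ∫ t in c..(c + δ), |V t| * ‖f t‖ ^ 2 ≤ M * B := by
      calc ∫ t in c..(c + δ), |V t| * ‖f t‖ ^ 2 ≤ ∫ t in c..(c + δ), |V t| * B := by
            refine intervalIntegral.integral_mono_on hcd.le
              (intervalIntegrable_potential hV hf.continuous _ _)
              ((intervalIntegrable_abs hV _ _).mul_const _) fun x hx => ?_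
            refine mul_le_mul_of_nonneg_left ?_ (abs_nonneg _)
            have := hf.norm_sq_le hcd (h2 _ _) hx
            rwa [add_sub_cancel_left] at this
        _ = (∫ t in c..(c + δ), |V t|) * B := intervalIntegral.integral_mul_const _ _
        _ ≤ M * B := by
            refine mul_le_mul_of_nonneg_right ?_ hB0
            refine le_trans ?_ (hM c)
            exact intervalIntegral.integral_mono_interval le_rfl hcd.le (by linarith)
              (ae_of_all _ fun _ => abs_nonneg _) (intervalIntegrable_abs hV _ _)
    have := add_le_add ih step
    rw [hB] at this
    refine this.trans (le_of_eq ?_)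
    ring

/-- A uniformly locally integrable potential is form-bounded with relative bound zero, uniformly
on all intervals of length at least one. -/
theorem exists_form_bound {V : ℝ → ℝ} (hV : LocallyIntegrable V volume)
    (hVcomp : Tendsto (fun x : ℝ => ∫ t in x..(x + 1), |V t|) (cocompact ℝ) (𝓝 0)) {ε : ℝ}
    (hε : 0 < ε) :
    ∃ C : ℝ, 0 ≤ C ∧ ∀ f : ℝ → ℂ, ACLoc f →
      (∀ a b, IntervalIntegrable (fun x => ‖deriv f x‖ ^ 2) volume a b) → ∀ a b, a + 1 ≤ b →
      ∫ t in a..b, |V t| * ‖f t‖ ^ 2 ≤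
        ε * (∫ t in a..b, ‖deriv f t‖ ^ 2) + C * ∫ t in a..b, ‖f t‖ ^ 2 := by
  obtain ⟨M, hM0, hM⟩ := exists_unif_bound hV hVcomp
  -- The choice gives `2 M δ₀ ≤ ε`; `M + 1` keeps the denominator positive when `M = 0`.
  set δ₀ := min 1 (ε / (2 * (M + 1))) with hδ₀
  have hp : 0 < δ₀ := lt_min one_pos (by positivity)
  have hl : δ₀ ≤ 1 := min_le_left _ _
  have hr : 2 * M * δ₀ ≤ ε := by
    have h1 : δ₀ ≤ ε / (2 * (M + 1)) := min_le_right _ _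
    rw [le_div_iff₀ (by positivity)] at h1
    nlinarith
  refine ⟨4 * M / δ₀, by positivity, fun f hf h2 a b hab => ?_⟩
  have hL : 1 ≤ b - a := by linarith
  -- The interval is cut into `n` equal cells. Their length `δ` lies between `δ₀ / 2` and `δ₀`, the
  -- lower bound because `b - a ≥ 1 ≥ δ₀`; so the constant `4 M / δ₀` does not depend on the
  -- interval.
  set n := ⌈(b - a) / δ₀⌉₊ with hn
  have hn1 : (b - a) / δ₀ ≤ n := Nat.le_ceil _
  have hn2 : (n : ℝ) < (b - a) / δ₀ + 1 := Nat.ceil_lt_add_one (by positivity)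
  have hn0 : (0 : ℝ) < n := lt_of_lt_of_le (by positivity) hn1
  set δ := (b - a) / n with hδ
  have hδ0 : 0 < δ := by positivity
  have hδle : δ ≤ δ₀ := by
    rw [hδ, div_le_iff₀ hn0]
    rwa [div_le_iff₀ hp, mul_comm] at hn1
  have hδge : δ₀ / 2 ≤ δ := by
    rw [hδ, le_div_iff₀ hn0]
    have : (n : ℝ) * δ₀ < (b - a) + δ₀ := by
      have := mul_lt_mul_of_pos_right hn2 hp
      rwa [add_mul, div_mul_cancel₀ _ hp.ne', one_mul] at this
    nlinarith
  have hb : a + n * δ = b := by rw [hδ]; field_simp; ring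
  have := hf.integral_potential_le hV hM h2 hδ0 (hδle.trans hl) a n
  rw [hb] at this
  have i1 : 0 ≤ ∫ t in a..b, ‖f t‖ ^ 2 :=
    intervalIntegral.integral_nonneg (by linarith) fun _ _ => by positivity
  have i2 : 0 ≤ ∫ t in a..b, ‖deriv f t‖ ^ 2 :=
    intervalIntegral.integral_nonneg (by linarith) fun _ _ => by positivity
  refine this.trans ?_
  have c1 : M * (2 * δ) ≤ ε := by nlinarith
  have c2 : M * (2 / δ) ≤ 4 * M / δ₀ := by
    rw [show 4 * M / δ₀ = M * (2 / (δ₀ / 2)) by field_simp; ring]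
    gcongr
  nlinarith [mul_le_mul_of_nonneg_right c1 i2, mul_le_mul_of_nonneg_right c2 i1]

/-! ### Regularity of the maximal domain -/

theorem integrable_norm_sq {f : ℝ → ℂ} (hf : MemLp f 2 volume) :
    Integrable (fun x => ‖f x‖ ^ 2) volume := hf.integrable_norm_pow (by norm_num)

theorem intervalIntegral_le_integral {g : ℝ → ℝ} (hg : Integrable g volume) (h0 : ∀ x, 0 ≤ g x)
    {a b : ℝ} (hab : a ≤ b) : ∫ x in a..b, g x ≤ ∫ x, g x := by
  rw [intervalIntegral.integral_of_le hab]
  exact setIntegral_le_integral hg (ae_of_all _ h0)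

/-- A function with `f, f' ∈ AC_loc`, `f ∈ L²` and `-f'' + m² f + V f ∈ L²` has `f' ∈ L²`. -/
theorem memLp_deriv_of_schrodinger (m : ℝ) {V : ℝ → ℝ} (hV : LocallyIntegrable V volume)
    (hVcomp : Tendsto (fun x : ℝ => ∫ t in x..(x + 1), |V t|) (cocompact ℝ) (𝓝 0))
    {f w : ℝ → ℂ} (hf : ACLoc f) (hd : Differentiable ℝ f) (hf1 : ACLoc (deriv f))
    (hf2 : MemLp f 2 volume) (hw2 : MemLp w 2 volume)
    (hw : w =ᵐ[volume] schrodingerExpr m V f) : MemLp (deriv f) 2 volume := by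
  have hcf := hf.continuous
  have hcd := hf1.continuous
  have hc2 : Continuous fun x => ‖deriv f x‖ ^ 2 := hcd.norm.pow 2
  have hcf2 : Continuous fun x => ‖f x‖ ^ 2 := hcf.norm.pow 2
  have h2 : ∀ a b, IntervalIntegrable (fun x => ‖deriv f x‖ ^ 2) volume a b := fun a b =>
    hc2.intervalIntegrable _ _
  obtain ⟨C, hC0, hC⟩ := exists_form_bound hV hVcomp (ε := 1 / 2) (by norm_num)
  set k : ℝ → ℝ := fun x => (starRingEnd ℂ (f x) * deriv f x).re with hk
  set F : ℝ → ℝ := fun N => ∫ x in (-N)..N, ‖deriv f x‖ ^ 2 with hF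
  have hfw := integrable_conj_mul hf2 hw2
  set K : ℝ := C * (∫ x, ‖f x‖ ^ 2) + ∫ x, ‖starRingEnd ℂ (f x) * w x‖ with hK
  -- The real part of integration by parts on `[-N, N]`, with `f''` eliminated by the equation. Half
  -- of the derivative term absorbs the potential, and `K` collects what is bounded by the `L²`
  -- norms of `f` and `w`.
  have hest : ∀ N, 1 ≤ N → F N / 2 - K ≤ k N - k (-N) := by
    intro N hN
    have hNN : -N ≤ N := by linarith
    have e := congrArg Complex.re (hf.intervalIntegral_conj_deriv_mul_self hf1 (-N) N)
    have hint : IntervalIntegrable (fun x => starRingEnd ℂ (deriv f x) * deriv f x +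
        starRingEnd ℂ (f x) * deriv (deriv f) x) volume (-N) N := by
      refine ((hf1.conj.continuous.mul hcd).intervalIntegrable _ _).add ?_
      exact (hf1.intervalIntegrable_deriv _ _).continuousOn_mul hf.conj.continuous.continuousOn
    have e2 := Complex.reCLM.intervalIntegral_comp_comm hint
    simp only [Complex.reCLM_apply] at e2
    rw [← e2, Complex.sub_re] at e
    have e3 : ∫ x in (-N)..N, (starRingEnd ℂ (deriv f x) * deriv f x +
        starRingEnd ℂ (f x) * deriv (deriv f) x).re =
        ∫ x in (-N)..N, (‖deriv f x‖ ^ 2 + m ^ 2 * ‖f x‖ ^ 2 + V x * ‖f x‖ ^ 2 -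
          (starRingEnd ℂ (f x) * w x).re) := by
      refine intervalIntegral.integral_congr_ae ?_
      filter_upwards [hw] with x hx _
      have h1 : deriv (deriv f) x = (m : ℂ) ^ 2 * f x + (V x : ℂ) * f x - w x := by
        rw [hx, schrodingerExpr]; ring
      rw [h1, show starRingEnd ℂ (f x) * ((m : ℂ) ^ 2 * f x + (V x : ℂ) * f x - w x) =
        ((m ^ 2 + V x : ℝ) : ℂ) * (starRingEnd ℂ (f x) * f x) - starRingEnd ℂ (f x) * w x by
          push_cast; ring, Complex.conj_mul', Complex.conj_mul', Complex.add_re, Complex.sub_re,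
        ← Complex.ofReal_pow, ← Complex.ofReal_pow, ← Complex.ofReal_mul, Complex.ofReal_re,
        Complex.ofReal_re]
      ring
    have iV : IntervalIntegrable (fun x => V x * ‖f x‖ ^ 2) volume (-N) N :=
      (intervalIntegrable_iff.mpr
        ((hV.integrableOn_isCompact isCompact_uIcc).mono_set
          Set.uIoc_subset_uIcc)).mul_continuousOn hcf2.continuousOn
    have iw : IntervalIntegrable (fun x => (starRingEnd ℂ (f x) * w x).re) volume (-N) N :=
      hfw.re.intervalIntegrable
    have im : IntervalIntegrable (fun x => m ^ 2 * ‖f x‖ ^ 2) volume (-N) N :=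
      (hcf2.const_mul _).intervalIntegrable _ _
    rw [e3, intervalIntegral.integral_sub (((h2 _ _).add im).add iV) iw,
      intervalIntegral.integral_add ((h2 _ _).add im) iV,
      intervalIntegral.integral_add (h2 _ _) im] at e
    have b1 : 0 ≤ ∫ x in (-N)..N, m ^ 2 * ‖f x‖ ^ 2 :=
      intervalIntegral.integral_nonneg hNN fun _ _ => by positivity
    have b2 : -(∫ x in (-N)..N, V x * ‖f x‖ ^ 2) ≤ ∫ x in (-N)..N, |V x| * ‖f x‖ ^ 2 := by
      rw [← intervalIntegral.integral_neg]
      refine intervalIntegral.integral_mono_on hNN iV.neg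
        (intervalIntegrable_potential hV hcf _ _) fun x _ => ?_
      rw [← neg_mul]
      exact mul_le_mul_of_nonneg_right (neg_le_abs _) (by positivity)
    have b3 := hC f hf h2 (-N) N (by linarith)
    have b4 : ∫ x in (-N)..N, ‖f x‖ ^ 2 ≤ ∫ x, ‖f x‖ ^ 2 :=
      intervalIntegral_le_integral (integrable_norm_sq hf2) (fun _ => by positivity) hNN
    have b5 : ∫ x in (-N)..N, (starRingEnd ℂ (f x) * w x).re ≤
        ∫ x, ‖starRingEnd ℂ (f x) * w x‖ := by
      refine le_trans ?_ (intervalIntegral_le_integral hfw.norm (fun _ => norm_nonneg _) hNN)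
      exact intervalIntegral.integral_mono_on hNN iw hfw.norm.intervalIntegrable
        fun x _ => Complex.re_le_norm _
    have b6 := mul_le_mul_of_nonneg_left b4 hC0
    simp only [hF, hk, hK]
    linarith
  have hmono : ∀ a b, 0 ≤ a → a ≤ b → F a ≤ F b := fun a b h0 h =>
    intervalIntegral.integral_mono_interval (by linarith) (by linarith) h
      (ae_of_all _ fun _ => by positivity) (h2 _ _)
  have hbd : ∀ N, 1 ≤ N → F N ≤ 2 * K + 1 := by
    by_contra! hcon
    obtain ⟨N₀, hN₀, hlt⟩ := hcon
    -- By `hest`, `h' x = 2 (k x - k (-x)) ≥ F x - 2 K`. If `F` exceeded `2 K + 1` at `N₀`, then `h'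
    -- ≥ 1` from there on and `h ≥ 1` on a half-line, which is impossible since `‖f‖²` is
    -- integrable.
    set h : ℝ → ℝ := fun x => ‖f x‖ ^ 2 + ‖f (-x)‖ ^ 2 with hh
    have hsq : ∀ x, HasDerivAt (fun y => ‖f y‖ ^ 2) (2 * k x) x := by
      intro x
      have h1 := (hd x).hasDerivAt.norm_sq
      convert h1 using 2
      rw [real_inner_eq_re_inner ℂ]
      simp [hk, mul_comm]
    have hder : ∀ x, HasDerivAt h (2 * k x - 2 * k (-x)) x := by
      intro x
      have h1 := (hsq (-x)).scomp x (hasDerivAt_neg x)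
      have h2 : HasDerivAt h (2 * k x + (-1 : ℝ) • (2 * k (-x))) x := (hsq x).add h1
      exact h2.congr_deriv (by rw [smul_eq_mul]; ring)
    have hge : ∀ x, N₀ + 1 ≤ x → 1 ≤ h x := by
      intro x hx
      have hm : ∀ y ∈ Set.Icc N₀ x, 1 ≤ deriv h y := by
        intro y hy
        rw [(hder y).deriv]
        have := hest y (hN₀.trans hy.1)
        have := hmono N₀ y (by linarith) hy.1
        linarith
      have hdiff : Differentiable ℝ h := fun y => (hder y).differentiableAt
      have := (convex_Icc N₀ x).mul_sub_le_image_sub_of_le_deriv hdiff.continuous.continuousOn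
        hdiff.differentiableOn (C := 1) (fun y hy => hm y (interior_subset hy)) N₀
        ⟨le_rfl, by linarith⟩ x ⟨by linarith, le_rfl⟩ (by linarith)
      have hpos : 0 ≤ h N₀ := by positivity
      linarith
    have hint : Integrable h volume :=
      (integrable_norm_sq hf2).add (integrable_norm_sq hf2).comp_neg
    have hone : IntegrableOn (fun _ : ℝ => (1 : ℝ)) (Set.Ici (N₀ + 1)) volume := by
      refine Integrable.mono hint.integrableOn (by fun_prop) ?_
      refine (ae_restrict_iff' measurableSet_Ici).2 (ae_of_all _ fun x hx => ?_)
      rw [norm_one, Real.norm_eq_abs]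
      exact (hge x hx).trans (le_abs_self _)
    rw [integrableOn_const_iff] at hone
    simp at hone
  have hInt : Integrable (fun x => ‖deriv f x‖ ^ 2) volume := by
    refine integrable_of_intervalIntegral_norm_bounded (a := fun n : ℕ => -(n : ℝ))
      (b := fun n : ℕ => (n : ℝ)) (l := atTop) (2 * K + 1)
      (fun i => (h2 _ _).1) (tendsto_neg_atTop_atBot.comp tendsto_natCast_atTop_atTop)
      tendsto_natCast_atTop_atTop ?_
    filter_upwards [eventually_ge_atTop 1] with n hn
    simpa using hbd n (by exact_mod_cast hn)
  exact (memLp_two_iff_integrable_sq_norm hcd.aestronglyMeasurable).2 hInt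

/-! ### The quadratic form of the Schrödinger operator -/

/-- The form `∫ V conj(v) u`. -/
noncomputable def potentialForm (V : ℝ → ℝ) (v u : L2) : ℂ := ∫ x, (V x : ℂ) * (starRingEnd ℂ (v x) * u x)

/-- The constants of `exists_form_bound` do not depend on the interval, so exhausting the line by
`[-n, n]` yields both the integrability and the estimate. -/
theorem exists_potential_bound {V : ℝ → ℝ} (hV : LocallyIntegrable V volume)
    (hVcomp : Tendsto (fun x : ℝ => ∫ t in x..(x + 1), |V t|) (cocompact ℝ) (𝓝 0)) {ε : ℝ}
    (hε : 0 < ε) :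
    ∃ C : ℝ, 0 ≤ C ∧ ∀ u p : L2, (u, p) ∈ D.graph →
      Integrable (fun x => |V x| * ‖u x‖ ^ 2) volume ∧
      ∫ x, |V x| * ‖u x‖ ^ 2 ≤ ε * ‖p‖ ^ 2 + C * ‖u‖ ^ 2 := by
  obtain ⟨C, hC0, hC⟩ := exists_form_bound hV hVcomp hε
  refine ⟨C, hC0, fun u p hup => ?_⟩
  rw [D_graph] at hup
  obtain ⟨f, hf, huf, hpf⟩ := hup
  simp only at huf hpf
  have mu := (memLp_congr_ae huf).1 (Lp.memLp u)
  have mp := (memLp_congr_ae hpf).1 (Lp.memLp p)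
  have eu : ‖u‖ ^ 2 = ∫ x, ‖f x‖ ^ 2 := by
    rw [L2.norm_sq]
    exact integral_congr_ae (huf.mono fun x hx => by simp only [hx])
  have ep : ‖p‖ ^ 2 = ∫ x, ‖deriv f x‖ ^ 2 := by
    rw [L2.norm_sq]
    exact integral_congr_ae (hpf.mono fun x hx => by simp only [hx])
  have ae : (fun x => |V x| * ‖f x‖ ^ 2) =ᵐ[volume] fun x => |V x| * ‖u x‖ ^ 2 :=
    huf.mono fun x hx => by simp only [hx]
  have bd : ∀ n : ℕ, 1 ≤ n → ∫ x in (-(n : ℝ))..n, |V x| * ‖f x‖ ^ 2 ≤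
      ε * ‖p‖ ^ 2 + C * ‖u‖ ^ 2 := by
    intro n hn
    have hn' : (1 : ℝ) ≤ n := by exact_mod_cast hn
    refine (hC f hf (fun a b => (integrable_norm_sq mp).intervalIntegrable) _ _
      (by linarith)).trans ?_
    rw [eu, ep]
    gcongr
    · exact intervalIntegral_le_integral (integrable_norm_sq mp) (fun _ => by positivity)
        (by linarith)
    · exact intervalIntegral_le_integral (integrable_norm_sq mu) (fun _ => by positivity)
        (by linarith)
  have ta : Tendsto (fun n : ℕ => -(n : ℝ)) atTop atBot :=
    tendsto_neg_atTop_atBot.comp tendsto_natCast_atTop_atTop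
  have hInt : Integrable (fun x => |V x| * ‖f x‖ ^ 2) volume := by
    refine integrable_of_intervalIntegral_norm_bounded (l := atTop)
      (ε * ‖p‖ ^ 2 + C * ‖u‖ ^ 2) (fun i => (intervalIntegrable_potential hV hf.continuous _ _).1) ta
      tendsto_natCast_atTop_atTop ?_
    filter_upwards [eventually_ge_atTop 1] with n hn
    simpa using bd n hn
  refine ⟨hInt.congr ae, ?_⟩
  rw [← integral_congr_ae ae]
  refine le_of_tendsto (intervalIntegral_tendsto_integral hInt ta tendsto_natCast_atTop_atTop) ?_
  filter_upwards [eventually_ge_atTop 1] with n hn using bd n hn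

theorem integrable_potentialForm {V : ℝ → ℝ} (hV : LocallyIntegrable V volume) {v u : L2}
    (hv : Integrable (fun x => |V x| * ‖v x‖ ^ 2) volume)
    (hu : Integrable (fun x => |V x| * ‖u x‖ ^ 2) volume) :
    Integrable (fun x => (V x : ℂ) * (starRingEnd ℂ (v x) * u x)) volume := by
  refine (hv.add hu).mono' ?_ (ae_of_all _ fun x => ?_)
  · refine (Complex.continuous_ofReal.comp_aestronglyMeasurable hV.aestronglyMeasurable).mul ?_
    exact (Complex.continuous_conj.comp_aestronglyMeasurable
      (Lp.aestronglyMeasurable v)).mul (Lp.aestronglyMeasurable u)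
  · rw [norm_mul, norm_mul, Complex.norm_real, Real.norm_eq_abs, RCLike.norm_conj, Pi.add_apply,
      ← mul_add]
    refine mul_le_mul_of_nonneg_left ?_ (abs_nonneg _)
    nlinarith [sq_nonneg (‖v x‖ - ‖u x‖), sq_nonneg (‖v x‖), sq_nonneg (‖u x‖)]

/-- Integration by parts on the line requires `conj(v) u''` to be integrable. The equation expresses
it through `conj(v) u`, `V conj(v) u` and `conj(v) w`, each of which is integrable for `v` in
`W^{1,2}`. -/
theorem H_form {m : ℝ} {V : ℝ → ℝ} (hV : LocallyIntegrable V volume)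
    (hVcomp : Tendsto (fun x : ℝ => ∫ t in x..(x + 1), |V t|) (cocompact ℝ) (𝓝 0)) {u w : L2}
    (huw : (u, w) ∈ (H m V).graph) :
    ∃ p, (u, p) ∈ D.graph ∧ ∀ v q : L2, (v, q) ∈ D.graph →
      inner ℂ v w = inner ℂ q p + (m : ℂ) ^ 2 * inner ℂ v u + potentialForm V v u := by
  rw [H_graph] at huw
  obtain ⟨f, hf, hd, hf1, huf, hwf⟩ := huw
  simp only at huf hwf
  have mu := (memLp_congr_ae huf).1 (Lp.memLp u)
  have mp := memLp_deriv_of_schrodinger m hV hVcomp hf hd hf1 mu (Lp.memLp w) hwf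
  have hup : (u, mp.toLp) ∈ D.graph := by
    rw [D_graph]
    exact ⟨f, hf, huf, mp.coeFn_toLp⟩
  refine ⟨mp.toLp, hup, fun v q hvq => ?_⟩
  obtain ⟨C, -, hC⟩ := exists_potential_bound hV hVcomp one_pos
  have iV := integrable_potentialForm hV (hC v q hvq).1 (hC u _ hup).1
  rw [D_graph] at hvq
  obtain ⟨g, hg, hvg, hqg⟩ := hvq
  simp only at hvg hqg
  have mv := (memLp_congr_ae hvg).1 (Lp.memLp v)
  have mq := (memLp_congr_ae hqg).1 (Lp.memLp q)
  have ivu := integrable_conj_mul (Lp.memLp v) (Lp.memLp u)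
  have ivw := integrable_conj_mul (Lp.memLp v) (Lp.memLp w)
  have hsum := ((ivu.const_mul ((m : ℂ) ^ 2)).add iV).sub ivw
  have ae : (fun x => starRingEnd ℂ (g x) * deriv (deriv f) x) =ᵐ[volume]
      fun x => (m : ℂ) ^ 2 * (starRingEnd ℂ (v x) * u x) +
        (V x : ℂ) * (starRingEnd ℂ (v x) * u x) - starRingEnd ℂ (v x) * w x := by
    filter_upwards [hvg, huf, hwf] with x h1 h2 h3
    rw [h3, schrodingerExpr, h1, h2]
    ring
  have ibp := hg.integral_conj_deriv_mul hf1 (integrable_conj_mul mv mp)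
    (integrable_conj_mul mq mp) (hsum.congr ae.symm)
  have s1 : ∫ x, ((m : ℂ) ^ 2 * (starRingEnd ℂ (v x) * u x) +
        (V x : ℂ) * (starRingEnd ℂ (v x) * u x) - starRingEnd ℂ (v x) * w x) =
      (m : ℂ) ^ 2 * inner ℂ v u + potentialForm V v u - inner ℂ v w := by
    refine (integral_sub ((ivu.const_mul _).add iV) ivw).trans ?_
    rw [integral_add' (ivu.const_mul _) iV, integral_const_mul, L2.inner_def, L2.inner_def, potentialForm]
  rw [integral_congr_ae ae, s1] at ibp
  have s2 : inner ℂ q mp.toLp = ∫ x, starRingEnd ℂ (deriv g x) * deriv f x := by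
    rw [L2.inner_def]
    refine integral_congr_ae ?_
    filter_upwards [hqg, mp.coeFn_toLp] with x h1 h2
    rw [h1, h2]
  rw [s2, ibp]
  ring

/-! ### A complex Lax–Milgram lemma -/

section LaxMilgram

variable {W : Type*} [NormedAddCommGroup W] [InnerProductSpace ℂ W]

/-- The hypothesis, applied to the normalized vectors, bounds the form by `2 C` there. -/
theorem norm_sesq_le (B : W →ₗ⋆[ℂ] W →ₗ[ℂ] ℂ) {C : ℝ}
    (hB : ∀ v u, ‖B v u‖ ≤ C * (‖v‖ ^ 2 + ‖u‖ ^ 2)) (v u : W) :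
    ‖B v u‖ ≤ 2 * C * ‖v‖ * ‖u‖ := by
  rcases eq_or_ne v 0 with rfl | hv
  · simp
  rcases eq_or_ne u 0 with rfl | hu
  · simp
  have hv' := norm_pos_iff.2 hv
  have hu' := norm_pos_iff.2 hu
  have h := hB (((‖v‖⁻¹ : ℝ) : ℂ) • v) (((‖u‖⁻¹ : ℝ) : ℂ) • u)
  rw [map_smulₛₗ (B _), map_smulₛₗ B, LinearMap.smul_apply, norm_smul, norm_smul, norm_smul,
    norm_smul] at h
  simp only [Complex.ofReal_inv, map_inv₀, Complex.conj_ofReal, RingHom.id_apply, norm_inv, Complex.norm_real,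
    norm_norm, inv_mul_cancel₀ hv'.ne', inv_mul_cancel₀ hu'.ne'] at h
  have e : ‖u‖⁻¹ * (‖v‖⁻¹ * ‖B v u‖) = ‖B v u‖ / (‖v‖ * ‖u‖) := by field_simp
  rw [e, div_le_iff₀ (by positivity)] at h
  linarith

/-- The bounded operator `M` representing `B` is bounded below by coercivity, so its range is
closed; a vector `z` orthogonal to the range is orthogonal to `M z`, so coercivity forces `z = 0`.
-/
theorem exists_rep_of_coercive [CompleteSpace W] (B : W →ₗ⋆[ℂ] W →ₗ[ℂ] ℂ) {C c : ℝ}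
    (hB : ∀ v u, ‖B v u‖ ≤ C * (‖v‖ ^ 2 + ‖u‖ ^ 2)) (hc : 0 < c)
    (hco : ∀ u, c * ‖u‖ ^ 2 ≤ (B u u).re) (w : W) :
    ∃ y, ∀ u, B y u = inner ℂ w u := by
  let B' : W →L⋆[ℂ] W →L[ℂ] ℂ := B.mkContinuous₂ (2 * C) (norm_sesq_le B hB)
  let M := InnerProductSpace.continuousLinearMapOfBilin B'
  have hM : ∀ v u, inner ℂ (M v) u = B v u := fun v u =>
    InnerProductSpace.continuousLinearMapOfBilin_apply B' v u
  have hbelow : ∀ v, ‖v‖ ≤ (⟨c⁻¹, by positivity⟩ : NNReal) * ‖M v‖ := by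
    intro v
    rcases eq_or_ne v 0 with rfl | hv
    · simp
    have hv' := norm_pos_iff.2 hv
    have h1 := hco v
    rw [← hM] at h1
    have h2 := h1.trans ((Complex.re_le_norm _).trans (norm_inner_le_norm _ _))
    have h3 : c * ‖v‖ ≤ ‖M v‖ := by
      refine le_of_mul_le_mul_right ?_ hv'
      linarith [sq ‖v‖]
    change ‖v‖ ≤ c⁻¹ * ‖M v‖
    rwa [inv_mul_eq_div, le_div_iff₀ hc, mul_comm]
  have hcl : IsClosed (M.range : Set W) :=
    (AddMonoidHomClass.antilipschitz_of_bound M hbelow).isClosed_range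
      M.uniformContinuous
  have : CompleteSpace M.range := hcl.completeSpace_coe
  have htop : M.range = ⊤ := by
    rw [← Submodule.orthogonal_eq_bot_iff, Submodule.eq_bot_iff]
    intro z hz
    have h1 : inner ℂ (M z) z = 0 := hz (M z) ⟨z, rfl⟩
    rw [hM] at h1
    have h2 := hco z
    rw [h1, Complex.zero_re] at h2
    have h3 : ‖z‖ ^ 2 = 0 := le_antisymm (nonpos_of_mul_nonpos_right h2 hc) (sq_nonneg _)
    simpa using h3
  obtain ⟨y, hy⟩ : w ∈ M.range := htop ▸ Submodule.mem_top
  refine ⟨y, fun u => ?_⟩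
  rw [← hM]
  exact congrArg (fun z => inner ℂ z u) hy

end LaxMilgram

/-! ### The graph norm of `D` and the core property of the Schrödinger domain -/

/-- The graph of `D`, as a Hilbert space. -/
noncomputable abbrev W12Graph : Submodule ℂ L2xL2 :=
  D.graph.comap (WithLp.linearEquiv 2 ℂ (L2 × L2)).toLinearMap

theorem isClosed_W12Graph : IsClosed (W12Graph : Set L2xL2) :=
  D_isClosed.preimage (WithLp.prod_continuous_ofLp 2 L2 L2)

instance : CompleteSpace W12Graph := isClosed_W12Graph.completeSpace_coe

theorem potentialForm_conj (V : ℝ → ℝ) (v u : L2) :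
    starRingEnd ℂ (potentialForm V v u) = potentialForm V u v := by
  rw [potentialForm, potentialForm, ← integral_conj]
  refine integral_congr_ae (ae_of_all _ fun x => ?_)
  simp only [map_mul, Complex.conj_ofReal, Complex.conj_conj]
  ring

theorem norm_potentialForm_le {V : ℝ → ℝ} {v u : L2}
    (hv : Integrable (fun x => |V x| * ‖v x‖ ^ 2) volume)
    (hu : Integrable (fun x => |V x| * ‖u x‖ ^ 2) volume) :
    ‖potentialForm V v u‖ ≤ ((∫ x, |V x| * ‖v x‖ ^ 2) + ∫ x, |V x| * ‖u x‖ ^ 2) / 2 := by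
  rw [potentialForm, ← integral_add hv hu, ← integral_div]
  refine norm_integral_le_of_norm_le ((hv.add hu).div_const 2) (ae_of_all _ fun x => ?_)
  rw [norm_mul, norm_mul, Complex.norm_real, Real.norm_eq_abs, RCLike.norm_conj, ← mul_add,
    mul_div_assoc]
  refine mul_le_mul_of_nonneg_left ?_ (abs_nonneg _)
  nlinarith [sq_nonneg (‖v x‖ - ‖u x‖)]


section Form

variable {V : ℝ → ℝ}

theorem integrable_potentialForm_W12 (hV : LocallyIntegrable V volume)
    (hVcomp : Tendsto (fun x : ℝ => ∫ t in x..(x + 1), |V t|) (cocompact ℝ) (𝓝 0))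
    (v u : W12Graph) :
    Integrable (fun x => (V x : ℂ) * (starRingEnd ℂ (v.1.fst x) * u.1.fst x)) volume := by
  obtain ⟨C, -, hC⟩ := exists_potential_bound hV hVcomp one_pos
  exact integrable_potentialForm hV (hC _ _ v.2).1 (hC _ _ u.2).1

theorem potentialForm_add_right (hV : LocallyIntegrable V volume)
    (hVcomp : Tendsto (fun x : ℝ => ∫ t in x..(x + 1), |V t|) (cocompact ℝ) (𝓝 0))
    (v u u' : W12Graph) :
    potentialForm V v.1.fst (u.1.fst + u'.1.fst) =
      potentialForm V v.1.fst u.1.fst + potentialForm V v.1.fst u'.1.fst := by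
  rw [potentialForm, potentialForm, potentialForm,
    ← integral_add (integrable_potentialForm_W12 hV hVcomp v u)
      (integrable_potentialForm_W12 hV hVcomp v u')]
  refine integral_congr_ae ?_
  filter_upwards [Lp.coeFn_add u.1.fst u'.1.fst] with x hx
  rw [hx, Pi.add_apply]
  ring

theorem potentialForm_smul_right (c : ℂ) (v u : L2) :
    potentialForm V v (c • u) = c * potentialForm V v u := by
  rw [potentialForm, potentialForm, ← integral_const_mul]
  refine integral_congr_ae ?_
  filter_upwards [Lp.coeFn_smul c u] with x hx
  rw [hx, Pi.smul_apply, smul_eq_mul]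
  ring

/-- The sesquilinear form `⟨v', u'⟩ + μ ⟨v, u⟩ + ∫ V conj(v) u` on `W^{1,2}(ℝ)`. -/
noncomputable def schrodingerForm (hV : LocallyIntegrable V volume)
    (hVcomp : Tendsto (fun x : ℝ => ∫ t in x..(x + 1), |V t|) (cocompact ℝ) (𝓝 0)) (μ : ℝ) :
    W12Graph →ₗ⋆[ℂ] W12Graph →ₗ[ℂ] ℂ :=
  LinearMap.mk₂'ₛₗ (starRingEnd ℂ) (RingHom.id ℂ)
    (fun v u => inner ℂ v.1.snd u.1.snd + (μ : ℂ) * inner ℂ v.1.fst u.1.fst +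
      potentialForm V v.1.fst u.1.fst)
    -- Additivity in the first argument follows from the second by Hermitian symmetry.
    (fun v v' u => by
      have h := potentialForm_add_right hV hVcomp u v v'
      have h' := congrArg (starRingEnd ℂ) h
      rw [map_add, potentialForm_conj, potentialForm_conj, potentialForm_conj] at h'
      simp only [Submodule.coe_add, WithLp.add_fst, WithLp.add_snd, inner_add_left, h']
      ring)
    (fun c v u => by
      have h' := congrArg (starRingEnd ℂ) (potentialForm_smul_right (V := V) c u.1.fst v.1.fst)
      rw [map_mul, potentialForm_conj, potentialForm_conj] at h'
      simp only [Submodule.coe_smul, WithLp.smul_fst, WithLp.smul_snd, inner_smul_left, h',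
        smul_eq_mul]
      ring)
    (fun v u u' => by
      simp only [Submodule.coe_add, WithLp.add_fst, WithLp.add_snd, inner_add_right,
        potentialForm_add_right hV hVcomp]
      ring)
    (fun c v u => by
      simp only [Submodule.coe_smul, WithLp.smul_fst, WithLp.smul_snd, inner_smul_right,
        potentialForm_smul_right, smul_eq_mul, RingHom.id_apply]
      ring)

theorem W12Graph_norm_sq (u : W12Graph) : ‖u‖ ^ 2 = ‖u.1.fst‖ ^ 2 + ‖u.1.snd‖ ^ 2 :=
  WithLp.prod_norm_sq_eq_of_L2 u.1

/-- The shifted form is bounded and coercive. -/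
theorem exists_schrodingerForm_coercive (hV : LocallyIntegrable V volume)
    (hVcomp : Tendsto (fun x : ℝ => ∫ t in x..(x + 1), |V t|) (cocompact ℝ) (𝓝 0)) :
    ∃ μ : ℝ, (∀ u : W12Graph, (1 / 2) * ‖u‖ ^ 2 ≤ (schrodingerForm hV hVcomp μ u u).re) ∧
      ∃ C, ∀ v u, ‖schrodingerForm hV hVcomp μ v u‖ ≤ C * (‖v‖ ^ 2 + ‖u‖ ^ 2) := by
  obtain ⟨C, hC0, hC⟩ := exists_potential_bound hV hVcomp (ε := 1 / 2) (by norm_num)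
  -- The relative bound `1/2` uses up half of `‖u'‖²`; the shift `C + 1/2` compensates `C ‖u‖²` and
  -- leaves `1/2 ‖u‖²`.
  refine ⟨C + 1 / 2, fun u => ?_, 1 + (C + 1 / 2) + (1 + C), fun v u => ?_⟩
  · change _ ≤ (inner ℂ u.1.snd u.1.snd + ((C + 1 / 2 : ℝ) : ℂ) * inner ℂ u.1.fst u.1.fst +
      potentialForm V u.1.fst u.1.fst).re
    have h1 := hC _ _ u.2
    have h2 := norm_potentialForm_le h1.1 h1.1
    have h3 := (abs_le.1 (Complex.abs_re_le_norm (potentialForm V u.1.fst u.1.fst))).1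
    rw [Complex.add_re, Complex.add_re, Complex.re_ofReal_mul]
    have e1 : (inner ℂ u.1.snd u.1.snd).re = ‖u.1.snd‖ ^ 2 := inner_self_eq_norm_sq (𝕜 := ℂ) _
    have e2 : (inner ℂ u.1.fst u.1.fst).re = ‖u.1.fst‖ ^ 2 := inner_self_eq_norm_sq (𝕜 := ℂ) _
    rw [e1, e2, W12Graph_norm_sq]
    have h4 := h1.2
    change ‖potentialForm V u.1.fst u.1.fst‖ ≤ _ at h2
    change (∫ x, |V x| * ‖u.1.fst x‖ ^ 2) ≤ 1 / 2 * ‖u.1.snd‖ ^ 2 + C * ‖u.1.fst‖ ^ 2 at h4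
    change ‖potentialForm V u.1.fst u.1.fst‖ ≤
      ((∫ x, |V x| * ‖u.1.fst x‖ ^ 2) + ∫ x, |V x| * ‖u.1.fst x‖ ^ 2) / 2 at h2
    linarith
  · change ‖inner ℂ v.1.snd u.1.snd + ((C + 1 / 2 : ℝ) : ℂ) * inner ℂ v.1.fst u.1.fst +
      potentialForm V v.1.fst u.1.fst‖ ≤ _
    have hv := hC _ _ v.2
    have hu := hC _ _ u.2
    have h2 : ‖potentialForm V v.1.fst u.1.fst‖ ≤ _ := norm_potentialForm_le hv.1 hu.1
    have hv2 : (∫ x, |V x| * ‖v.1.fst x‖ ^ 2) ≤ 1 / 2 * ‖v.1.snd‖ ^ 2 + C * ‖v.1.fst‖ ^ 2 := hv.2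
    have hu2 : (∫ x, |V x| * ‖u.1.fst x‖ ^ 2) ≤ 1 / 2 * ‖u.1.snd‖ ^ 2 + C * ‖u.1.fst‖ ^ 2 := hu.2
    have h2' : ‖potentialForm V v.1.fst u.1.fst‖ ≤
      ((∫ x, |V x| * ‖v.1.fst x‖ ^ 2) + ∫ x, |V x| * ‖u.1.fst x‖ ^ 2) / 2 := h2
    have i1 : ‖inner ℂ v.1.snd u.1.snd‖ ≤ ‖v.1.snd‖ * ‖u.1.snd‖ := norm_inner_le_norm _ _
    have i2 : ‖inner ℂ v.1.fst u.1.fst‖ ≤ ‖v.1.fst‖ * ‖u.1.fst‖ := norm_inner_le_norm _ _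
    have i3 : ‖((C + 1 / 2 : ℝ) : ℂ) * inner ℂ v.1.fst u.1.fst‖ ≤
        (C + 1 / 2) * (‖v.1.fst‖ * ‖u.1.fst‖) := by
      rw [norm_mul, Complex.norm_real, Real.norm_of_nonneg (by positivity)]
      gcongr
    refine (norm_add₃_le).trans ?_
    rw [W12Graph_norm_sq, W12Graph_norm_sq]
    have j1 : ‖v.1.snd‖ * ‖u.1.snd‖ ≤ ‖v.1.snd‖ ^ 2 + ‖u.1.snd‖ ^ 2 := by
      nlinarith [sq_nonneg (‖v.1.snd‖ - ‖u.1.snd‖), sq_nonneg ‖v.1.snd‖, sq_nonneg ‖u.1.snd‖]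
    have j2 : ‖v.1.fst‖ * ‖u.1.fst‖ ≤ ‖v.1.fst‖ ^ 2 + ‖u.1.fst‖ ^ 2 := by
      nlinarith [sq_nonneg (‖v.1.fst‖ - ‖u.1.fst‖), sq_nonneg ‖v.1.fst‖, sq_nonneg ‖u.1.fst‖]
    have j3 := mul_le_mul_of_nonneg_left j2 (by positivity : 0 ≤ C + 1 / 2)
    have k1 := sq_nonneg ‖v.1.snd‖
    have k2 := sq_nonneg ‖u.1.snd‖
    have k3 := sq_nonneg ‖v.1.fst‖
    have k4 := sq_nonneg ‖u.1.fst‖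
    nlinarith [mul_nonneg hC0 k1, mul_nonneg hC0 k2, mul_nonneg hC0 k3, mul_nonneg hC0 k4]

end Form

/-! ### The resolvent of the Schrödinger operator and its mapping properties -/

theorem MemResolventSet.exists_inverse {E : Type*} [NormedAddCommGroup E] [InnerProductSpace ℂ E]
    {T : E →ₗ.[ℂ] E} (h : MemResolventSet T 0) :
    ∃ R : E →L[ℂ] E, ∀ x y, (x, y) ∈ T.graph ↔ x = R y := by
  obtain ⟨R, h1, h2⟩ := h
  refine ⟨R, fun x y => ⟨fun hxy => ?_, ?_⟩⟩
  · obtain ⟨x, rfl, rfl⟩ := T.mem_graph_iff.1 hxy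
    simpa using (h2 x).symm
  · rintro rfl
    obtain ⟨hd, hT⟩ := h1 y
    rw [zero_smul, sub_zero] at hT
    exact T.mem_graph_iff.2 ⟨⟨R y, hd⟩, rfl, hT⟩

/-- A closed operator composed with a bounded operator mapping into its domain is bounded. -/
theorem exists_comp_of_closed {E F : Type*} [NormedAddCommGroup E] [InnerProductSpace ℂ E]
    [NormedAddCommGroup F] [InnerProductSpace ℂ F] [CompleteSpace E] [CompleteSpace F]
    (T : F →ₗ.[ℂ] F) (hT : IsClosed (T.graph : Set (F × F))) (R : E →L[ℂ] F)
    (h : ∀ w, R w ∈ T.domain) : ∃ A : E →L[ℂ] F, ∀ w, (R w, A w) ∈ T.graph := by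
  let A₀ : E →ₗ[ℂ] F := T.toFun.comp (R.toLinearMap.codRestrict T.domain h)
  have hA : ∀ w, (R w, A₀ w) ∈ T.graph := fun w => T.mem_graph_iff.2 ⟨⟨R w, h w⟩, rfl, rfl⟩
  have hcl : IsClosed (A₀.graph : Set (E × F)) := by
    have : (A₀.graph : Set (E × F)) = (fun p : E × F => (R p.1, p.2)) ⁻¹' T.graph := by
      ext ⟨w, z⟩
      simp only [SetLike.mem_coe, LinearMap.mem_graph_iff, Set.mem_preimage]
      constructor
      · rintro rfl
        exact hA w
      · intro hz
        exact T.mem_graph_snd_inj' hz (hA w) rfl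
    rw [this]
    exact hT.preimage ((R.continuous.comp continuous_fst).prodMk continuous_snd)
  exact ⟨ContinuousLinearMap.ofIsClosedGraph hcl, hA⟩

/-- `R` is the bounded symmetric inverse of `H`, whose domain is contained in the domain of the
closed, densely defined, skew-symmetric operator `D` as a core, `A = D R`, and the quadratic form of
`H` is comparable with `‖D u‖²` up to an arbitrarily small relative error from below. -/
structure ResolventPair {E : Type*} [NormedAddCommGroup E] [InnerProductSpace ℂ E]
    (D H : E →ₗ.[ℂ] E) (R A : E →L[ℂ] E) : Prop where
  skew : ∀ {u p v q : E}, (u, p) ∈ D.graph → (v, q) ∈ D.graph → inner ℂ p v = -inner ℂ u q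
  closed : IsClosed (D.graph : Set (E × E))
  dense : Dense (D.domain : Set E)
  graph : ∀ u w, (u, w) ∈ H.graph ↔ u = R w
  symm : ∀ u v, inner ℂ (R u) v = inner ℂ u (R v)
  deriv : ∀ w, (R w, A w) ∈ D.graph
  lower : ∀ ε > 0, ∃ c : ℝ, 0 ≤ c ∧ ∀ w,
    (1 - ε) * ‖A w‖ ^ 2 - c * ‖R w‖ ^ 2 ≤ (inner ℂ (R w) w).re
  upper : ∃ C : ℝ, 0 ≤ C ∧ ∀ w, ‖inner ℂ (R w) w‖ ≤ C * (‖A w‖ ^ 2 + ‖R w‖ ^ 2)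
  core : ∀ {u p : E}, (u, p) ∈ D.graph → ∀ ε > 0, ∃ w, ‖R w - u‖ < ε ∧ ‖A w - p‖ < ε

/-- This isolates everything the block operator needs from the Schrödinger operator. The symmetry of
`R` is read off the Hermitian form, the two form bounds come from the relative bound of `V`, and the
core property comes from coercivity of the shifted form. -/
theorem exists_resolventPair {m : ℝ} {V : ℝ → ℝ} (hV : LocallyIntegrable V volume)
    (hVcomp : Tendsto (fun x : ℝ => ∫ t in x..(x + 1), |V t|) (cocompact ℝ) (𝓝 0))
    (h0 : MemResolventSet (H m V) 0) : ∃ R A : L2 →L[ℂ] L2, ResolventPair D (H m V) R A := by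
  obtain ⟨R, hR⟩ := h0.exists_inverse
  have hRw : ∀ w, (R w, w) ∈ (H m V).graph := fun w => (hR _ _).2 rfl
  have hdom : ∀ w, R w ∈ D.domain := fun w => by
    obtain ⟨p, hp, -⟩ := H_form hV hVcomp (hRw w)
    exact LinearPMap.mem_domain_of_mem_graph hp
  obtain ⟨A, hA⟩ := exists_comp_of_closed D D_isClosed R hdom
  have hform : ∀ w v q, (v, q) ∈ D.graph →
      inner ℂ v w = inner ℂ q (A w) + (m : ℂ) ^ 2 * inner ℂ v (R w) + potentialForm V v (R w) := by
    intro w v q hvq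
    obtain ⟨p, hp, hH⟩ := H_form hV hVcomp (hRw w)
    have e : p = A w := D.mem_graph_snd_inj' hp (hA w) rfl
    rw [hH v q hvq, e]
  have hsymm : ∀ u v, inner ℂ (R u) v = inner ℂ u (R v) := by
    intro u v
    have h1 := hform v (R u) (A u) (hA u)
    have h2 := congrArg (starRingEnd ℂ) (hform u (R v) (A v) (hA v))
    rw [h1, ← inner_conj_symm u (R v), h2]
    simp only [map_add, map_mul, map_pow, Complex.conj_ofReal, inner_conj_symm, potentialForm_conj]
  have hre : ∀ w, (inner ℂ (R w) w).re =
      ‖A w‖ ^ 2 + m ^ 2 * ‖R w‖ ^ 2 + (potentialForm V (R w) (R w)).re := by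
    intro w
    rw [hform w (R w) (A w) (hA w), Complex.add_re, Complex.add_re, ← Complex.ofReal_pow,
      Complex.re_ofReal_mul]
    have e1 : (inner ℂ (A w) (A w)).re = ‖A w‖ ^ 2 := inner_self_eq_norm_sq (𝕜 := ℂ) _
    have e2 : (inner ℂ (R w) (R w)).re = ‖R w‖ ^ 2 := inner_self_eq_norm_sq (𝕜 := ℂ) _
    rw [e1, e2]
  have hpot : ∀ ε > 0, ∃ c : ℝ, 0 ≤ c ∧ ∀ w,
      ‖potentialForm V (R w) (R w)‖ ≤ ε * ‖A w‖ ^ 2 + c * ‖R w‖ ^ 2 := by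
    intro ε hε
    obtain ⟨C, hC0, hC⟩ := exists_potential_bound hV hVcomp hε
    refine ⟨C, hC0, fun w => ?_⟩
    have h1 := hC _ _ (hA w)
    have h2 := norm_potentialForm_le h1.1 h1.1
    linarith [h1.2]
  refine ⟨R, A, D_skew, D_isClosed, dense_W12, hR, hsymm, hA, fun ε hε => ?_, ?_, ?_⟩
  · obtain ⟨c, hc0, hc⟩ := hpot ε hε
    refine ⟨c, hc0, fun w => ?_⟩
    rw [hre]
    have := (abs_le.1 ((Complex.abs_re_le_norm _).trans (hc w))).1
    nlinarith [mul_nonneg (sq_nonneg m) (sq_nonneg ‖R w‖)]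
  · obtain ⟨c, hc0, hc⟩ := hpot 1 one_pos
    refine ⟨2 + m ^ 2 + c, by positivity, fun w => ?_⟩
    rw [hform w (R w) (A w) (hA w)]
    refine norm_add₃_le.trans ?_
    have e1 : ‖inner ℂ (A w) (A w)‖ ≤ ‖A w‖ * ‖A w‖ := norm_inner_le_norm _ _
    have e2 : ‖(m : ℂ) ^ 2 * inner ℂ (R w) (R w)‖ ≤ m ^ 2 * (‖R w‖ * ‖R w‖) := by
      rw [norm_mul, norm_pow, Complex.norm_real, Real.norm_eq_abs, sq_abs]
      exact mul_le_mul_of_nonneg_left (norm_inner_le_norm _ _) (sq_nonneg m)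
    have e3 := hc w
    nlinarith [mul_nonneg (sq_nonneg m) (sq_nonneg ‖A w‖), mul_nonneg hc0 (sq_nonneg ‖A w‖),
      sq_nonneg ‖A w‖, sq_nonneg ‖R w‖]
  · obtain ⟨μ, hco, C, hC⟩ := exists_schrodingerForm_coercive hV hVcomp
    let J : L2 →ₗ[ℂ] W12Graph :=
      { toFun := fun w => ⟨WithLp.toLp 2 (R w, A w), hA w⟩
        map_add' := fun u v => by
          apply Subtype.ext
          simp [← WithLp.toLp_add]
        map_smul' := fun c u => by
          apply Subtype.ext
          simp [← WithLp.toLp_smul] }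
    -- On vectors `R w` the shifted form is the pairing with `(H + μ - m²) R w`.
    have hJ : ∀ (y : W12Graph) w, schrodingerForm hV hVcomp μ y (J w) =
        inner ℂ y.1.fst (w + ((μ - m ^ 2 : ℝ) : ℂ) • R w) := by
      intro y w
      change inner ℂ y.1.snd (A w) + (μ : ℂ) * inner ℂ y.1.fst (R w) +
        potentialForm V y.1.fst (R w) = _
      have h1 : inner ℂ y.1.fst w = inner ℂ y.1.snd (A w) + (m : ℂ) ^ 2 * inner ℂ y.1.fst (R w) +
        potentialForm V y.1.fst (R w) := hform w _ _ y.2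
      rw [inner_add_right, inner_smul_right, h1]
      push_cast
      ring
    have hdense : J.range.topologicalClosure = ⊤ := by
      rw [Submodule.topologicalClosure_eq_top_iff, Submodule.eq_bot_iff]
      intro x hx
      -- A vector `x` orthogonal to the range of `J` is represented by some `y` through the form.
      -- Orthogonality and the symmetry of `R` give `y₁ = -(μ - m²) R y₁`. Hence `y` itself lies in
      -- the range of `J`, the form vanishes at `(y, y)`, and coercivity gives `y = 0`.
      obtain ⟨y, hy⟩ := exists_rep_of_coercive _ hC (by norm_num) hco x
      have hy0 : ∀ w, inner ℂ y.1.fst (w + ((μ - m ^ 2 : ℝ) : ℂ) • R w) = 0 := by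
        intro w
        rw [← hJ, hy]
        exact inner_eq_zero_symm.1 (hx (J w) ⟨w, rfl⟩)
      have hy1 : y.1.fst + ((μ - m ^ 2 : ℝ) : ℂ) • R y.1.fst = 0 := by
        refine ext_inner_right ℂ fun w => ?_
        rw [inner_zero_left, ← hy0 w, inner_add_left, inner_add_right, inner_smul_left,
          inner_smul_right, hsymm, Complex.conj_ofReal]
      have hy2 : y = J (-((μ - m ^ 2 : ℝ) : ℂ) • y.1.fst) := by
        have e1 : y.1.fst = R (-((μ - m ^ 2 : ℝ) : ℂ) • y.1.fst) := by
          rw [map_smul, neg_smul]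
          exact eq_neg_of_add_eq_zero_left hy1
        have e2 : y.1.snd = A (-((μ - m ^ 2 : ℝ) : ℂ) • y.1.fst) :=
          D.mem_graph_snd_inj' y.2 (hA _) e1
        apply Subtype.ext
        apply (WithLp.ofLp_injective 2)
        exact Prod.ext e1 e2
      have hy3 : schrodingerForm hV hVcomp μ y y = 0 := by
        conv_lhs => arg 2; rw [hy2]
        rw [hJ, hy0]
      have hy4 : y = 0 := by
        have := hco y
        rw [hy3, Complex.zero_re] at this
        have h3 : ‖y‖ ^ 2 = 0 := le_antisymm (by linarith) (sq_nonneg _)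
        simpa using h3
      refine ext_inner_right ℂ fun u => ?_
      rw [inner_zero_left, ← hy u, hy4, map_zero, LinearMap.zero_apply]
    intro u p hup ε hε
    let x : W12Graph := ⟨WithLp.toLp 2 (u, p), hup⟩
    have hx : x ∈ closure (J.range : Set W12Graph) := by
      have : x ∈ J.range.topologicalClosure := hdense ▸ Submodule.mem_top
      exact this
    obtain ⟨_, ⟨w, rfl⟩, hw⟩ := Metric.mem_closure_iff.1 hx ε hε
    rw [dist_comm, dist_eq_norm] at hw
    have hsq := W12Graph_norm_sq (J w - x)
    have e1 : (J w - x).1.fst = R w - u := rfl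
    have e2 : (J w - x).1.snd = A w - p := rfl
    rw [e1, e2] at hsq
    refine ⟨w, ?_, ?_⟩ <;> refine lt_of_le_of_lt (abs_le_of_sq_le_sq' ?_ (norm_nonneg _)).2 hw <;>
      rw [hsq] <;> nlinarith [sq_nonneg ‖R w - u‖, sq_nonneg ‖A w - p‖]

/-! ### Graphs of sums, products and blocks of operators -/

section Graphs

variable {E F : Type*} [NormedAddCommGroup E] [InnerProductSpace ℂ E]
  [NormedAddCommGroup F] [InnerProductSpace ℂ F]

/-- A bounded operator as an operator with domain `⊤`. -/
def ofCLM (B : E →L[ℂ] F) : E →ₗ.[ℂ] F := B.toLinearMap.toPMap ⊤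

theorem mem_graph_ofCLM (B : E →L[ℂ] F) (x : E) (y : F) :
    (x, y) ∈ (ofCLM B).graph ↔ y = B x := by
  rw [LinearPMap.mem_graph_iff]
  constructor
  · rintro ⟨z, rfl, rfl⟩
    rfl
  · rintro rfl
    exact ⟨⟨x, Submodule.mem_top⟩, rfl, rfl⟩

theorem eq_ofCLM {T : E →ₗ.[ℂ] F} (B : E →L[ℂ] F) (h : ∀ x y, (x, y) ∈ T.graph ↔ y = B x) :
    T = ofCLM B := by
  refine LinearPMap.eq_of_eq_graph ?_
  ext ⟨x, y⟩
  rw [h, mem_graph_ofCLM]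

theorem mem_graph_smul (c : ℂ) (T : E →ₗ.[ℂ] F) (x : E) (y : F) :
    (x, y) ∈ (c • T).graph ↔ ∃ z, (x, z) ∈ T.graph ∧ y = c • z := by
  simp only [LinearPMap.mem_graph_iff]
  constructor
  · rintro ⟨z, rfl, rfl⟩
    exact ⟨T z, ⟨z, rfl, rfl⟩, rfl⟩
  · rintro ⟨_, ⟨z, rfl, rfl⟩, rfl⟩
    exact ⟨z, rfl, rfl⟩

theorem mem_graph_neg (T : E →ₗ.[ℂ] F) (x : E) (y : F) :
    (x, y) ∈ (-T).graph ↔ ∃ z, (x, z) ∈ T.graph ∧ y = -z := by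
  simp only [LinearPMap.mem_graph_iff]
  constructor
  · rintro ⟨z, rfl, rfl⟩
    exact ⟨T z, ⟨z, rfl, rfl⟩, rfl⟩
  · rintro ⟨_, ⟨z, rfl, rfl⟩, rfl⟩
    exact ⟨z, rfl, rfl⟩

theorem mem_graph_sub (S T : E →ₗ.[ℂ] F) (x : E) (y : F) :
    (x, y) ∈ (S - T).graph ↔ ∃ a b, (x, a) ∈ S.graph ∧ (x, b) ∈ T.graph ∧ y = a - b := by
  simp only [LinearPMap.mem_graph_iff]
  constructor
  · rintro ⟨z, rfl, rfl⟩
    exact ⟨S ⟨z, z.2.1⟩, T ⟨z, z.2.2⟩, ⟨⟨z, z.2.1⟩, rfl, rfl⟩, ⟨⟨z, z.2.2⟩, rfl, rfl⟩, rfl⟩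
  · rintro ⟨_, _, ⟨z, rfl, rfl⟩, ⟨⟨_, hz⟩, rfl, rfl⟩, rfl⟩
    exact ⟨⟨z, z.2, hz⟩, rfl, rfl⟩

theorem mem_graph_one (x y : E) : (x, y) ∈ (one E).graph ↔ y = x := by
  rw [LinearPMap.mem_graph_iff]
  constructor
  · rintro ⟨z, rfl, rfl⟩
    rfl
  · rintro rfl
    exact ⟨⟨y, Submodule.mem_top⟩, rfl, rfl⟩

theorem mem_graph_zero (x : E) (y : F) : (x, y) ∈ (0 : E →ₗ.[ℂ] F).graph ↔ y = 0 := by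
  rw [LinearPMap.mem_graph_iff]
  constructor
  · rintro ⟨z, rfl, rfl⟩
    rfl
  · rintro rfl
    exact ⟨⟨x, Submodule.mem_top⟩, rfl, rfl⟩

theorem mem_graph_block (A B C D : E →ₗ.[ℂ] E) (f g : WithLp 2 (E × E)) :
    (f, g) ∈ (block A B C D).graph ↔ ∃ a b c d, (f.fst, a) ∈ A.graph ∧ (f.snd, b) ∈ B.graph ∧
      (f.fst, c) ∈ C.graph ∧ (f.snd, d) ∈ D.graph ∧ g.fst = a + b ∧ g.snd = c + d := by
  rw [LinearPMap.mem_graph_iff]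
  constructor
  · rintro ⟨z, rfl, rfl⟩
    exact ⟨_, _, _, _, A.mem_graph ⟨z.1.fst, z.2.1.1⟩, B.mem_graph ⟨z.1.snd, z.2.2.1⟩,
      C.mem_graph ⟨z.1.fst, z.2.1.2⟩, D.mem_graph ⟨z.1.snd, z.2.2.2⟩, rfl, rfl⟩
  · rintro ⟨a, b, c, d, ha, hb, hc, hd, h1, h2⟩
    have hA := LinearPMap.mem_domain_of_mem_graph ha
    have hB := LinearPMap.mem_domain_of_mem_graph hb
    have hC := LinearPMap.mem_domain_of_mem_graph hc
    have hD := LinearPMap.mem_domain_of_mem_graph hd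
    refine ⟨⟨f, ⟨hA, hC⟩, ⟨hB, hD⟩⟩, rfl, WithLp.ofLp_injective 2 (Prod.ext ?_ ?_)⟩
    · refine Eq.trans ?_ h1.symm
      exact congrArg₂ (· + ·) (A.mem_graph_snd_inj' (A.mem_graph ⟨_, hA⟩) ha rfl)
        (B.mem_graph_snd_inj' (B.mem_graph ⟨_, hB⟩) hb rfl)
    · refine Eq.trans ?_ h2.symm
      exact congrArg₂ (· + ·) (C.mem_graph_snd_inj' (C.mem_graph ⟨_, hC⟩) hc rfl)
        (D.mem_graph_snd_inj' (D.mem_graph ⟨_, hD⟩) hd rfl)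

theorem closure_eq_of_graph {T S : E →ₗ.[ℂ] F} (h : T.graph.topologicalClosure = S.graph) :
    T.IsClosable ∧ T.closure = S := by
  have hT : T.IsClosable := ⟨S, h⟩
  exact ⟨hT, LinearPMap.eq_of_eq_graph (hT.graph_closure_eq_closure_graph.symm.trans h)⟩

/-- A densely defined restriction of a bounded operator has this operator as its closure. -/
theorem closure_eq_ofCLM {T : E →ₗ.[ℂ] F} (B : E →L[ℂ] F) (hd : Dense (T.domain : Set E))
    (hT : ∀ x y, (x, y) ∈ T.graph → y = B x) : T.IsClosable ∧ T.closure = ofCLM B := by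
  refine closure_eq_of_graph (le_antisymm (Submodule.topologicalClosure_minimal _ ?_ ?_) ?_)
  · rintro ⟨x, y⟩ h
    exact (mem_graph_ofCLM B x y).2 (hT x y h)
  · have : ((ofCLM B).graph : Set (E × F)) = {p | p.2 = B p.1} := by
      ext ⟨x, y⟩
      exact mem_graph_ofCLM B x y
    rw [this]
    exact isClosed_eq continuous_snd (B.continuous.comp continuous_fst)
  · rintro ⟨x, y⟩ h
    rw [mem_graph_ofCLM] at h
    subst h
    have hc : Continuous fun x => (x, B x) := continuous_id.prodMk B.continuous
    refine map_mem_closure (f := fun x => (x, B x)) hc (hd x) fun x hx => ?_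
    obtain ⟨y, hy⟩ := LinearPMap.mem_domain_iff.1 hx
    have := hT x y hy
    subst this
    exact hy

end Graphs

/-! ### The block operator associated with a resolvent pair -/

section Block

variable {E : Type*} [NormedAddCommGroup E] [InnerProductSpace ℂ E]
  {D H : E →ₗ.[ℂ] E} {R A B G : E →L[ℂ] E}

namespace ResolventPair

theorem mem_graph (h : ResolventPair D H R A) (w : E) : (R w, w) ∈ H.graph := (h.graph _ _).2 rfl

theorem eq_deriv (h : ResolventPair D H R A) {w p : E} (hp : (R w, p) ∈ D.graph) : p = A w :=
  D.mem_graph_snd_inj' hp (h.deriv w) rfl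

theorem eq_zero_of_apply_eq_zero (h : ResolventPair D H R A) {w : E} (hw : R w = 0) : w = 0 :=
  H.graph_fst_eq_zero_snd (hw ▸ h.mem_graph w) rfl

theorem mem_inverse_graph (h : ResolventPair D H R A) (w u : E) :
    (w, u) ∈ H.inverse.graph ↔ u = R w := by
  -- Injectivity guarantees that `inverse` has the transposed graph.
  have hk : LinearMap.ker H.toFun = ⊥ := by
    rw [LinearMap.ker_eq_bot']
    intro x hx
    have h1 := (h.graph _ _).1 (H.mem_graph x)
    change H x = 0 at hx
    rw [hx, map_zero] at h1
    exact Subtype.ext h1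
  rw [LinearPMap.inverse_graph hk, ← h.graph]
  constructor
  · rintro ⟨⟨a, b⟩, hab, h2⟩
    obtain ⟨rfl, rfl⟩ := Prod.ext_iff.1 h2
    exact hab
  · intro hu
    exact ⟨(u, w), hu, rfl⟩

theorem pcomp_inverse (h : ResolventPair D H R A) : pcomp D H.inverse = ofCLM A := by
  refine eq_ofCLM A fun w y => ?_
  rw [mem_graph_pcomp]
  constructor
  · rintro ⟨x, hx, hy⟩
    rw [h.mem_inverse_graph] at hx
    subst hx
    exact h.eq_deriv hy
  · rintro rfl
    exact ⟨R w, (h.mem_inverse_graph _ _).2 rfl, h.deriv w⟩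

theorem mem_graph_inverse_pcomp (h : ResolventPair D H R A) (u y : E) :
    (u, y) ∈ (pcomp H.inverse D).graph ↔ ∃ p, (u, p) ∈ D.graph ∧ y = R p := by
  simp only [mem_graph_pcomp, h.mem_inverse_graph]

theorem inverse_pcomp_domain (h : ResolventPair D H R A) :
    (pcomp H.inverse D).domain = D.domain := by
  ext u
  simp only [LinearPMap.mem_domain_iff, h.mem_graph_inverse_pcomp]
  exact ⟨fun ⟨_, p, hp, _⟩ => ⟨p, hp⟩, fun ⟨p, hp⟩ => ⟨_, p, hp, rfl⟩⟩

/-- `B = -A^*` extends `R D`. -/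
theorem exists_B [CompleteSpace E] (h : ResolventPair D H R A) :
    ∃ B : E →L[ℂ] E, (∀ u w, inner ℂ (B u) w = -inner ℂ u (A w)) ∧
      ∀ u p, (u, p) ∈ D.graph → R p = B u := by
  have hB : ∀ u w, inner ℂ ((-(ContinuousLinearMap.adjoint A)) u) w = -inner ℂ u (A w) := by
    intro u w
    rw [neg_apply, inner_neg_left, ContinuousLinearMap.adjoint_inner_left]
  -- For `p = D u`: `⟨R p, w⟩ = ⟨p, R w⟩ = -⟨u, A w⟩`.
  refine ⟨_, hB, fun u p hp => ext_inner_right ℂ fun w => ?_⟩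
  rw [hB, h.symm, h.skew hp (h.deriv w)]

theorem closure_inverse_pcomp (h : ResolventPair D H R A)
    (hB : ∀ u p, (u, p) ∈ D.graph → R p = B u) :
    (pcomp H.inverse D).IsClosable ∧ (pcomp H.inverse D).closure = ofCLM B := by
  refine closure_eq_ofCLM B (by rw [h.inverse_pcomp_domain]; exact h.dense) fun u y hy => ?_
  obtain ⟨p, hp, rfl⟩ := (h.mem_graph_inverse_pcomp u y).1 hy
  exact hB u p hp

/-- `D R D` is bounded. -/
theorem exists_G [CompleteSpace E] (h : ResolventPair D H R A)
    (hB : ∀ u p, (u, p) ∈ D.graph → R p = B u) :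
    ∃ G : E →L[ℂ] E, ∀ u p, (u, p) ∈ D.graph → A p = G u := by
  obtain ⟨c, hc0, hc⟩ := h.lower (1 / 2) (by norm_num)
  set K : ℝ := 2 + 2 * c * ‖B‖ ^ 2 with hK
  -- Since `⟨R p, p⟩ = -⟨A p, u⟩`, the lower bound with `ε = 1/2` becomes `‖A p‖² ≤ 2 ‖A p‖ ‖u‖ + 2
  -- c ‖B‖² ‖u‖²`, a quadratic inequality that fails once `‖A p‖ > K ‖u‖`.
  have hbound : ∀ u p, (u, p) ∈ D.graph → ‖A p‖ ≤ K * ‖u‖ := by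
    intro u p hup
    have h1 := hc p
    have h2 : (inner ℂ (R p) p).re ≤ ‖A p‖ * ‖u‖ := by
      have e : inner ℂ (R p) p = -inner ℂ (A p) u := by
        rw [h.skew (h.deriv p) hup, neg_neg]
      rw [e, Complex.neg_re]
      refine (neg_le_abs _).trans ((Complex.abs_re_le_norm _).trans (norm_inner_le_norm _ _))
    have h3 : ‖R p‖ ≤ ‖B‖ * ‖u‖ := by
      rw [hB u p hup]
      exact B.le_opNorm u
    have h4 : ‖R p‖ ^ 2 ≤ ‖B‖ ^ 2 * ‖u‖ ^ 2 := by
      rw [← mul_pow]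
      gcongr
    have h5 : ‖A p‖ ^ 2 ≤ 2 * (‖A p‖ * ‖u‖) + 2 * c * ‖B‖ ^ 2 * ‖u‖ ^ 2 := by
      nlinarith [mul_le_mul_of_nonneg_left h4 hc0]
    by_contra! hlt
    have hu := norm_nonneg u
    have hb : 0 ≤ 2 * c * ‖B‖ ^ 2 := by positivity
    have h6 : 2 * c * ‖B‖ ^ 2 * ‖u‖ < ‖A p‖ - 2 * ‖u‖ := by rw [hK] at hlt; linarith
    have h7 : ‖u‖ ≤ ‖A p‖ := by nlinarith [mul_nonneg hb hu]
    have h8 : 0 < ‖A p‖ := by nlinarith [mul_nonneg hb hu]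
    nlinarith [mul_lt_mul_of_pos_left h6 h8,
      mul_le_mul_of_nonneg_left h7 (mul_nonneg hb hu)]
  let g : D.domain →L[ℂ] E := (A.toLinearMap.comp D.toFun).mkContinuous K fun u =>
    hbound u (D u) (D.mem_graph u)
  refine ⟨g.extend D.domain.subtypeL, fun u p hup => ?_⟩
  obtain ⟨u, rfl, rfl⟩ := D.mem_graph_iff.1 hup
  exact (ContinuousLinearMap.extend_eq g h.dense.denseRange_val
    isUniformEmbedding_subtype_val.isUniformInducing u).symm

/-- By continuity it suffices to argue on the domain of `D`, where `G = D R D` and the two signs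
from skewness cancel. -/
theorem G_symm (h : ResolventPair D H R A) (hG : ∀ u p, (u, p) ∈ D.graph → A p = G u) (u v : E) :
    inner ℂ (G u) v = inner ℂ u (G v) := by
  have hdense : Dense ((D.domain : Set E) ×ˢ (D.domain : Set E)) := h.dense.prod h.dense
  have := Continuous.ext_on hdense (f := fun x : E × E => inner ℂ (G x.1) x.2)
    (g := fun x : E × E => inner ℂ x.1 (G x.2)) (by fun_prop) (by fun_prop) ?_
  · exact congrFun this (u, v)
  rintro ⟨u, v⟩ ⟨hu, hv⟩
  obtain ⟨p, hp⟩ := LinearPMap.mem_domain_iff.1 hu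
  obtain ⟨q, hq⟩ := LinearPMap.mem_domain_iff.1 hv
  simp only
  rw [← hG u p hp, ← hG v q hq, h.skew (h.deriv p) hq, h.symm, h.skew hp (h.deriv q), neg_neg]

/-- On the domain of `D` this says that `R D u` has derivative `A D u`; closedness of `D` extends it
to all `z`. It places first components of the closed block operator in the domain of `D`. -/
theorem B_deriv (h : ResolventPair D H R A) (hB : ∀ u p, (u, p) ∈ D.graph → R p = B u)
    (hG : ∀ u p, (u, p) ∈ D.graph → A p = G u) (z : E) : (B z, G z) ∈ D.graph := by
  have hc : Continuous fun z => (B z, G z) := B.continuous.prodMk G.continuous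
  have := map_mem_closure hc (h.dense z) (t := (D.graph : Set (E × E))) fun u hu => by
    obtain ⟨p, hp⟩ := LinearPMap.mem_domain_iff.1 hu
    rw [← hB u p hp, ← hG u p hp]
    exact h.deriv p
  rwa [h.closed.closure_eq] at this

/-- The first Schur complement `I - (ν D) H⁻¹ (-ν D)`. -/
theorem mem_graph_schur (h : ResolventPair D H R A) (ν : ℝ) (u y : E) :
    (u, y) ∈ (one E - pcomp ((ν : ℂ) • D) (pcomp H.inverse (-((ν : ℂ) • D)))).graph ↔
      ∃ p, (u, p) ∈ D.graph ∧ y = u + ((ν : ℂ) ^ 2) • A p := by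
  simp only [mem_graph_sub, mem_graph_one, mem_graph_pcomp, mem_graph_neg, mem_graph_smul,
    h.mem_inverse_graph]
  constructor
  · rintro ⟨_, _, rfl, ⟨_, ⟨_, ⟨_, ⟨p, hp, rfl⟩, rfl⟩, rfl⟩, ⟨e, he, rfl⟩⟩, rfl⟩
    refine ⟨p, hp, ?_⟩
    rw [h.eq_deriv he, map_neg, map_smul, smul_neg, smul_smul, sub_neg_eq_add, sq]
  · rintro ⟨p, hp, rfl⟩
    refine ⟨u, _, rfl, ⟨_, ⟨_, ⟨_, ⟨p, hp, rfl⟩, rfl⟩, rfl⟩, ⟨_, h.deriv _, rfl⟩⟩, ?_⟩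
    rw [map_neg, map_smul, smul_neg, smul_smul, sub_neg_eq_add, sq]

theorem schur_domain (h : ResolventPair D H R A) (ν : ℝ) :
    (one E - pcomp ((ν : ℂ) • D) (pcomp H.inverse (-((ν : ℂ) • D)))).domain = D.domain := by
  ext u
  simp only [LinearPMap.mem_domain_iff, h.mem_graph_schur]
  exact ⟨fun ⟨_, p, hp, _⟩ => ⟨p, hp⟩, fun ⟨p, hp⟩ => ⟨_, p, hp, rfl⟩⟩

theorem closure_schur (h : ResolventPair D H R A)
    (hG : ∀ u p, (u, p) ∈ D.graph → A p = G u) (ν : ℝ) :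
    (one E - pcomp ((ν : ℂ) • D) (pcomp H.inverse (-((ν : ℂ) • D)))).IsClosable ∧
      (one E - pcomp ((ν : ℂ) • D) (pcomp H.inverse (-((ν : ℂ) • D)))).closure =
        ofCLM (ContinuousLinearMap.id ℂ E + ((ν : ℂ) ^ 2) • G) := by
  refine closure_eq_ofCLM _ (by rw [h.schur_domain]; exact h.dense) fun u y hy => ?_
  obtain ⟨p, hp, rfl⟩ := (h.mem_graph_schur ν u y).1 hy
  rw [hG u p hp]
  rfl

end ResolventPair

end Block

/-! ### Frobenius-Schur factorization, closure and self-adjointness -/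

section Block

variable {E : Type*} [NormedAddCommGroup E] [InnerProductSpace ℂ E]
  {D H : E →ₗ.[ℂ] E} {R A B G : E →L[ℂ] E} {T : WithLp 2 (E × E) →ₗ.[ℂ] WithLp 2 (E × E)} {ν : ℝ}

namespace ResolventPair

/-- The graph of the Frobenius–Schur factorization. -/
theorem mem_graph_frobenius (h : ResolventPair D H R A) (f g : WithLp 2 (E × E)) :
    (f, g) ∈ (pcomp (block (one E) 0 ((ν : ℂ) • ofCLM A) (one E))
      (pcomp (block H 0 0 (ofCLM (ContinuousLinearMap.id ℂ E + ((ν : ℂ) ^ 2) • G)))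
        (block (one E) (-((ν : ℂ) • ofCLM B)) 0 (one E)))).graph ↔
      f.fst = R g.fst + (ν : ℂ) • B f.snd ∧
        g.snd = (ν : ℂ) • A g.fst + (f.snd + ((ν : ℂ) ^ 2) • G f.snd) := by
  simp only [mem_graph_pcomp, mem_graph_block, mem_graph_one, mem_graph_neg, mem_graph_smul,
    mem_graph_zero, mem_graph_ofCLM, h.graph]
  constructor
  · rintro ⟨k, ⟨l, ⟨a, b, c, d, rfl, ⟨_, ⟨_, rfl, rfl⟩, rfl⟩, rfl, rfl, h1, h2⟩,
      a', b', c', d', h3, rfl, rfl, rfl, h4, h5⟩, _, _, _, _, rfl, rfl, ⟨_, rfl, rfl⟩, rfl, h6, h7⟩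
    rw [add_zero] at h4 h6
    rw [zero_add] at h2 h5
    subst h4
    rw [h1] at h3
    rw [h6, h7, h5, h2]
    refine ⟨?_, rfl⟩
    rw [← h3]
    abel
  · rintro ⟨h1, h2⟩
    -- The right factor maps `f` to `(R g₁, f₂)`, and the diagonal factor maps that to `(g₁, f₂ + ν²
    -- G f₂)`.
    refine ⟨WithLp.toLp 2 (g.fst, f.snd + ((ν : ℂ) ^ 2) • G f.snd),
      ⟨WithLp.toLp 2 (R g.fst, f.snd),
        ⟨_, _, _, _, rfl, ⟨_, ⟨_, rfl, rfl⟩, rfl⟩, rfl, rfl, ?_, (zero_add _).symm⟩,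
        ⟨_, _, _, _, rfl, rfl, rfl, rfl, (add_zero _).symm, (zero_add _).symm⟩⟩,
      ⟨_, _, _, _, rfl, rfl, ⟨_, rfl, rfl⟩, rfl, (add_zero _).symm, h2⟩⟩
    rw [h1]
    change R g.fst = _
    abel

/-- The graph of the block operator matrix. -/
theorem mem_graph_block (h : ResolventPair D H R A) (f g : WithLp 2 (E × E)) :
    (f, g) ∈ (block H (-((ν : ℂ) • D)) ((ν : ℂ) • D) (one E)).graph ↔
      ∃ w q, f.fst = R w ∧ (f.snd, q) ∈ D.graph ∧ g.fst = w - (ν : ℂ) • q ∧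
        g.snd = (ν : ℂ) • A w + f.snd := by
  simp only [BlockOp.mem_graph_block, mem_graph_one, mem_graph_neg, mem_graph_smul, h.graph]
  constructor
  · rintro ⟨w, _, _, _, hw, ⟨_, ⟨q, hq, rfl⟩, rfl⟩, ⟨p, hp, rfl⟩, rfl, h1, h2⟩
    rw [hw] at hp
    rw [h.eq_deriv hp] at h2
    exact ⟨w, q, hw, hq, by rw [h1, sub_eq_add_neg], h2⟩
  · rintro ⟨w, q, hw, hq, h1, h2⟩
    exact ⟨w, _, _, _, hw, ⟨_, ⟨q, hq, rfl⟩, rfl⟩, ⟨A w, hw ▸ h.deriv w, rfl⟩, rfl,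
      by rw [h1, sub_eq_add_neg], h2⟩

/-- The graph of `T` is parametrized continuously by `(g₁, f₂)`, and the graph of the block matrix
is the part with `f₂` in the domain of `D`. Density of that domain, with `g₁` held fixed, gives the
closure. -/
theorem topologicalClosure_graph_block (h : ResolventPair D H R A)
    (hB : ∀ u p, (u, p) ∈ D.graph → R p = B u) (hG : ∀ u p, (u, p) ∈ D.graph → A p = G u)
    (hT : ∀ f g, (f, g) ∈ T.graph ↔ f.fst = R g.fst + (ν : ℂ) • B f.snd ∧
        g.snd = (ν : ℂ) • A g.fst + (f.snd + ((ν : ℂ) ^ 2) • G f.snd)) :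
    (block H (-((ν : ℂ) • D)) ((ν : ℂ) • D) (one E)).graph.topologicalClosure = T.graph := by
  have c1 : Continuous fun f : WithLp 2 (E × E) => f.fst :=
    continuous_fst.comp (WithLp.prod_continuous_ofLp 2 E E)
  have c2 : Continuous fun f : WithLp 2 (E × E) => f.snd :=
    continuous_snd.comp (WithLp.prod_continuous_ofLp 2 E E)
  refine le_antisymm (Submodule.topologicalClosure_minimal _ ?_ ?_) ?_
  · rintro ⟨f, g⟩ hfg
    obtain ⟨w, q, hw, hq, h1, h2⟩ := (h.mem_graph_block f g).1 hfg
    refine (hT f g).2 ⟨?_, ?_⟩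
    · rw [h1, map_sub, map_smul, hB _ q hq, hw, sub_add_cancel]
    · rw [h1, h2, map_sub, map_smul, hG _ q hq, smul_sub, smul_smul, sq]
      abel
  · have e : (T.graph : Set (WithLp 2 (E × E) × WithLp 2 (E × E))) =
        {p | p.1.fst = R p.2.fst + (ν : ℂ) • B p.1.snd} ∩
        {p | p.2.snd = (ν : ℂ) • A p.2.fst + (p.1.snd + ((ν : ℂ) ^ 2) • G p.1.snd)} := by
      ext ⟨f, g⟩
      exact hT f g
    rw [e]
    have d1 := c1.comp (continuous_fst (X := WithLp 2 (E × E)) (Y := WithLp 2 (E × E)))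
    have d2 := c2.comp (continuous_fst (X := WithLp 2 (E × E)) (Y := WithLp 2 (E × E)))
    have d3 := c1.comp (continuous_snd (X := WithLp 2 (E × E)) (Y := WithLp 2 (E × E)))
    have d4 := c2.comp (continuous_snd (X := WithLp 2 (E × E)) (Y := WithLp 2 (E × E)))
    refine (isClosed_eq d1 ?_).inter (isClosed_eq d4 ?_)
    · exact (R.continuous.comp d3).add ((B.continuous.comp d2).const_smul _)
    · exact ((A.continuous.comp d3).const_smul _).add
        (d2.add ((G.continuous.comp d2).const_smul _))
  · rintro ⟨f, g⟩ hfg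
    obtain ⟨h1, h2⟩ := (hT f g).1 hfg
    let Φ : E → WithLp 2 (E × E) × WithLp 2 (E × E) := fun z =>
      (WithLp.toLp 2 (R g.fst + (ν : ℂ) • B z, z),
        WithLp.toLp 2 (g.fst, (ν : ℂ) • A g.fst + (z + ((ν : ℂ) ^ 2) • G z)))
    have hΦ : Continuous Φ :=
      ((WithLp.prod_continuous_toLp 2 E E).comp (by fun_prop)).prodMk
        ((WithLp.prod_continuous_toLp 2 E E).comp (by fun_prop))
    have e : Φ f.snd = (f, g) := by
      refine Prod.ext (WithLp.ofLp_injective 2 (Prod.ext ?_ ?_))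
        (WithLp.ofLp_injective 2 (Prod.ext ?_ ?_))
      · exact h1.symm
      · rfl
      · rfl
      · exact h2.symm
    rw [← e]
    refine map_mem_closure hΦ (h.dense f.snd) fun z hz => ?_
    obtain ⟨q, hq⟩ := LinearPMap.mem_domain_iff.1 hz
    -- The shift by `ν q` makes the first output component `w - ν q` equal to `g₁`.
    refine (h.mem_graph_block _ _).2 ⟨g.fst + (ν : ℂ) • q, q, ?_, hq, ?_, ?_⟩
    · change R g.fst + (ν : ℂ) • B z = _
      rw [map_add, map_smul, hB z q hq]
    · exact (add_sub_cancel_right _ _).symm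
    · change (ν : ℂ) • A g.fst + (z + ((ν : ℂ) ^ 2) • G z) = (ν : ℂ) • A (g.fst + (ν : ℂ) • q) + z
      rw [map_add, map_smul, hG z q hq, smul_add, smul_smul, sq]
      abel

/-- The parameters `w = g₁` and `z = f₂` range freely over `E`. Testing the adjoint relation with `z
= 0` and with `w = 0` returns exactly the two equations of the graph, because `R` and `G` are
symmetric and `B = -A^*`. -/
theorem isSelfAdjoint [CompleteSpace E] (h : ResolventPair D H R A)
    (hBA : ∀ u w, inner ℂ (B u) w = -inner ℂ u (A w))
    (hG : ∀ u v, inner ℂ (G u) v = inner ℂ u (G v))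
    (hT : ∀ f g, (f, g) ∈ T.graph ↔ f.fst = R g.fst + (ν : ℂ) • B f.snd ∧
        g.snd = (ν : ℂ) • A g.fst + (f.snd + ((ν : ℂ) ^ 2) • G f.snd)) : IsSelfAdjoint T := by
  have hAB : ∀ u w, inner ℂ (A w) u = -inner ℂ w (B u) := fun u w => by
    rw [← inner_conj_symm, ← inner_conj_symm w, hBA, map_neg, neg_neg]
  have hmem : ∀ w z, (WithLp.toLp 2 (R w + (ν : ℂ) • B z, z),
      WithLp.toLp 2 (w, (ν : ℂ) • A w + (z + ((ν : ℂ) ^ 2) • G z))) ∈ T.graph := fun w z =>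
    (hT _ _).2 ⟨rfl, rfl⟩
  have hdense : Dense (T.domain : Set (WithLp 2 (E × E))) := by
    rw [Submodule.dense_iff_topologicalClosure_eq_top, Submodule.topologicalClosure_eq_top_iff,
      Submodule.eq_bot_iff]
    intro f hf
    -- For `f` orthogonal to the domain, `z = 0` gives `R f₁ = 0`, hence `f₁ = 0` by injectivity;
    -- then `w = 0` gives `f₂ = 0`.
    have key : ∀ w z, inner ℂ (R w + (ν : ℂ) • B z) f.fst + inner ℂ z f.snd = 0 := fun w z => by
      have := hf _ (LinearPMap.mem_domain_of_mem_graph (hmem w z))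
      rwa [WithLp.prod_inner_apply] at this
    have h1 : f.fst = 0 := by
      refine h.eq_zero_of_apply_eq_zero (ext_inner_left ℂ fun w => ?_)
      have := key w 0
      rw [map_zero, smul_zero, add_zero, inner_zero_left, add_zero] at this
      rw [← h.symm, this, inner_zero_right]
    have h2 : f.snd = 0 := by
      refine ext_inner_left ℂ fun z => ?_
      have := key 0 z
      rw [h1, inner_zero_right, zero_add] at this
      rw [this, inner_zero_right]
    exact WithLp.ofLp_injective 2 (Prod.ext h1 h2)
  rw [LinearPMap.isSelfAdjoint_def]
  refine LinearPMap.eq_of_eq_graph ?_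
  rw [LinearPMap.adjoint_graph_eq_graph_adjoint hdense]
  ext ⟨f, g⟩
  rw [Submodule.mem_adjoint_iff]
  constructor
  · intro hfg
    have key : ∀ w z, inner ℂ w f.fst + inner ℂ ((ν : ℂ) • A w + (z + ((ν : ℂ) ^ 2) • G z)) f.snd -
        (inner ℂ (R w + (ν : ℂ) • B z) g.fst + inner ℂ z g.snd) = 0 := fun w z => by
      have := hfg _ _ (hmem w z)
      rwa [WithLp.prod_inner_apply, WithLp.prod_inner_apply] at this
    refine (hT f g).2 ⟨ext_inner_left ℂ fun w => ?_, ext_inner_left ℂ fun z => ?_⟩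
    · have := key w 0
      simp only [map_zero, smul_zero, add_zero, inner_zero_left, inner_smul_left,
        Complex.conj_ofReal, hAB, h.symm] at this
      rw [inner_add_right, inner_smul_right]
      linear_combination this
    · have := key 0 z
      simp only [map_zero, smul_zero, zero_add, inner_zero_left, inner_smul_left, inner_add_left,
        Complex.conj_ofReal, hBA, hG, map_pow] at this
      rw [inner_add_right, inner_add_right, inner_smul_right, inner_smul_right]
      linear_combination -this
  · intro hfg a b hab
    obtain ⟨h1, h2⟩ := (hT f g).1 hfg
    obtain ⟨h3, h4⟩ := (hT a b).1 hab
    simp only [WithLp.prod_inner_apply]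
    change inner ℂ b.fst f.fst + inner ℂ b.snd f.snd -
      (inner ℂ a.fst g.fst + inner ℂ a.snd g.snd) = 0
    rw [h1, h2, h3, h4]
    simp only [inner_add_left, inner_add_right, inner_smul_left, inner_smul_right,
      Complex.conj_ofReal, map_pow, hAB, hBA, hG, h.symm]
    ring

end ResolventPair

end Block

theorem tendsto_norm_sub_sq {E : Type*} [NormedAddCommGroup E] {v : ℕ → E} {v₀ : E}
    (hv : Tendsto v atTop (𝓝 v₀)) :
    Tendsto (fun k : ℕ × ℕ => ‖v k.1 - v k.2‖ ^ 2) atTop (𝓝 0) := by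
  rw [← prod_atTop_atTop_eq]
  have h1 : Tendsto (fun k : ℕ × ℕ => v k.1) (atTop ×ˢ atTop) (𝓝 v₀) := hv.comp tendsto_fst
  have h2 : Tendsto (fun k : ℕ × ℕ => v k.2) (atTop ×ˢ atTop) (𝓝 v₀) := hv.comp tendsto_snd
  simpa using ((h1.sub h2).norm).pow 2

/-! ### Form bounds, semiboundedness and the form domain -/

section Block

variable {E : Type*} [NormedAddCommGroup E] [InnerProductSpace ℂ E]
  {D H : E →ₗ.[ℂ] E} {R A B G : E →L[ℂ] E} {T : WithLp 2 (E × E) →ₗ.[ℂ] WithLp 2 (E × E)} {ν : ℝ}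

namespace ResolventPair

/-- The quadratic form of the block operator matrix. -/
theorem inner_block (h : ResolventPair D H R A) {f g : WithLp 2 (E × E)} {w q : E}
    (hw : f.fst = R w) (hq : (f.snd, q) ∈ D.graph) (h1 : g.fst = w - (ν : ℂ) • q)
    (h2 : g.snd = (ν : ℂ) • A w + f.snd) :
    inner ℂ f g = inner ℂ (R w) w + (ν : ℂ) * (inner ℂ (A w) f.snd + inner ℂ f.snd (A w)) +
      inner ℂ f.snd f.snd := by
  have e : inner ℂ f g = inner ℂ f.fst g.fst + inner ℂ f.snd g.snd := WithLp.prod_inner_apply _ _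
  -- Skewness turns `-ν ⟨R w, q⟩` into `ν ⟨A w, f₂⟩`, so no derivative of `f₂` remains.
  rw [e, h1, h2, hw, inner_sub_right, inner_add_right, inner_smul_right, inner_smul_right,
    h.skew (h.deriv w) hq]
  ring

/-- The cross term is at most `|ν| (‖A w‖² + ‖f₂‖²)`. The relative error `ε = (1 - |ν|) / 2` in the
lower bound for `⟨R w, w⟩` then leaves `(1 - |ν|) / 2` in front of the squared derivative of `f₁`.
-/
theorem exists_form_lower (h : ResolventPair D H R A) (hν : |ν| < 1)
    (hB : ∀ u p, (u, p) ∈ D.graph → R p = B u) (hG : ∀ u p, (u, p) ∈ D.graph → A p = G u)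
    (hT : ∀ f g, (f, g) ∈ T.graph ↔ f.fst = R g.fst + (ν : ℂ) • B f.snd ∧
        g.snd = (ν : ℂ) • A g.fst + (f.snd + ((ν : ℂ) ^ 2) • G f.snd)) :
    ∃ δ > 0, ∃ c : ℝ, 0 ≤ c ∧ ∀ f g, (f, g) ∈ T.graph → ∃ p, (f.fst, p) ∈ D.graph ∧
      δ * ‖p‖ ^ 2 - c * ‖f.fst‖ ^ 2 ≤ (inner ℂ f g).re := by
  set r := |ν| with hr
  obtain ⟨c, hc0, hc⟩ := h.lower ((1 - r) / 2) (by linarith)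
  refine ⟨(1 - r) / 2, by linarith, c, hc0, fun f g hfg => ?_⟩
  obtain ⟨h1, h2⟩ := (hT f g).1 hfg
  refine ⟨A g.fst + (ν : ℂ) • G f.snd, ?_, ?_⟩
  · rw [h1]
    exact D.graph.add_mem (h.deriv _) (D.graph.smul_mem (ν : ℂ) (h.B_deriv hB hG f.snd))
  set w := g.fst with hw
  have e : inner ℂ f g = inner ℂ f.fst g.fst + inner ℂ f.snd g.snd := WithLp.prod_inner_apply _ _
  rw [e, h2, ← hw, h1]
  generalize f.snd = z
  -- With `g₁` fixed both sides are continuous in `f₂`, so `f₂` may be taken in the domain of `D`,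
  -- where the explicit form of the block matrix applies.
  have hcl : IsClosed {z : E | (1 - r) / 2 * ‖A w + (ν : ℂ) • G z‖ ^ 2 -
      c * ‖R w + (ν : ℂ) • B z‖ ^ 2 ≤ (inner ℂ (R w + (ν : ℂ) • B z) w +
        inner ℂ z ((ν : ℂ) • A w + (z + ((ν : ℂ) ^ 2) • G z))).re} :=
    isClosed_le (by fun_prop) (Complex.continuous_re.comp (by fun_prop))
  refine hcl.closure_subset_iff.2 ?_ (h.dense z)
  intro z hz
  obtain ⟨q, hq⟩ := LinearPMap.mem_domain_iff.1 hz
  change (1 - r) / 2 * ‖A w + (ν : ℂ) • G z‖ ^ 2 - c * ‖R w + (ν : ℂ) • B z‖ ^ 2 ≤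
    (inner ℂ (R w + (ν : ℂ) • B z) w + inner ℂ z ((ν : ℂ) • A w + (z + ((ν : ℂ) ^ 2) • G z))).re
  set w' := w + (ν : ℂ) • q with hw'
  have e1 : R w + (ν : ℂ) • B z = R w' := by rw [hw', map_add, map_smul, hB z q hq]
  have e2 : A w + (ν : ℂ) • G z = A w' := by rw [hw', map_add, map_smul, hG z q hq]
  have e3 := h.inner_block (ν := ν) (f := WithLp.toLp 2 (R w', z))
    (g := WithLp.toLp 2 (w, (ν : ℂ) • A w' + z)) (w := w') (q := q) rfl hq
    (add_sub_cancel_right _ _).symm rfl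
  rw [WithLp.prod_inner_apply] at e3
  have e4 : (ν : ℂ) • A w + (z + ((ν : ℂ) ^ 2) • G z) = (ν : ℂ) • A w' + z := by
    rw [← e2, smul_add, smul_smul, sq]
    abel
  rw [e1, e2, e4]
  change inner ℂ (R w') w + inner ℂ z ((ν : ℂ) • A w' + z) = inner ℂ (R w') w' +
    (ν : ℂ) * (inner ℂ (A w') z + inner ℂ z (A w')) + inner ℂ z z at e3
  rw [e3, Complex.add_re, Complex.add_re, Complex.re_ofReal_mul, Complex.add_re]
  have i1 : (inner ℂ z z).re = ‖z‖ ^ 2 := inner_self_eq_norm_sq (𝕜 := ℂ) _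
  have i2 := (Complex.abs_re_le_norm (inner ℂ (A w') z)).trans (norm_inner_le_norm _ _)
  have i3 := (Complex.abs_re_le_norm (inner ℂ z (A w'))).trans (norm_inner_le_norm _ _)
  have i4 := hc w'
  have i5 : |ν * ((inner ℂ (A w') z).re + (inner ℂ z (A w')).re)| ≤
      r * (2 * (‖A w'‖ * ‖z‖)) := by
    rw [abs_mul]
    refine mul_le_mul_of_nonneg_left ((abs_add_le _ _).trans ?_) (abs_nonneg _)
    linarith
  have i6 := (abs_le.1 i5).1
  have i7 : r * (2 * (‖A w'‖ * ‖z‖)) ≤ r * (‖A w'‖ ^ 2 + ‖z‖ ^ 2) :=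
    mul_le_mul_of_nonneg_left (by nlinarith [sq_nonneg (‖A w'‖ - ‖z‖)]) (abs_nonneg _)
  rw [i1]
  nlinarith [sq_nonneg ‖z‖, sq_nonneg ‖A w'‖]

theorem exists_form_upper (h : ResolventPair D H R A) (ν : ℝ) :
    ∃ C : ℝ, ∀ (f g : WithLp 2 (E × E)) (w : E),
      (f, g) ∈ (block H (-((ν : ℂ) • D)) ((ν : ℂ) • D) (one E)).graph → f.fst = R w →
      ‖inner ℂ f g‖ ≤ C * (‖A w‖ ^ 2 + ‖R w‖ ^ 2 + ‖f.snd‖ ^ 2) := by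
  obtain ⟨C, hC0, hC⟩ := h.upper
  refine ⟨C + |ν| + 1, fun f g w hfg hw => ?_⟩
  obtain ⟨w', q, hw', hq, h1, h2⟩ := (h.mem_graph_block f g).1 hfg
  obtain rfl : w' = w := by
    have : R (w' - w) = 0 := by rw [map_sub, ← hw, ← hw', sub_self]
    exact sub_eq_zero.1 (h.eq_zero_of_apply_eq_zero this)
  rw [h.inner_block hw' hq h1 h2]
  refine norm_add₃_le.trans ?_
  have i1 : ‖inner ℂ f.snd f.snd‖ ≤ ‖f.snd‖ * ‖f.snd‖ := norm_inner_le_norm _ _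
  have i2 : ‖inner ℂ (A w') f.snd‖ ≤ ‖A w'‖ * ‖f.snd‖ := norm_inner_le_norm _ _
  have i3 : ‖inner ℂ f.snd (A w')‖ ≤ ‖f.snd‖ * ‖A w'‖ := norm_inner_le_norm _ _
  have i4 : ‖(ν : ℂ) * (inner ℂ (A w') f.snd + inner ℂ f.snd (A w'))‖ ≤
      |ν| * (‖A w'‖ ^ 2 + ‖f.snd‖ ^ 2) := by
    rw [norm_mul, Complex.norm_real, Real.norm_eq_abs]
    refine mul_le_mul_of_nonneg_left ((norm_add_le _ _).trans ?_) (abs_nonneg _)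
    nlinarith [sq_nonneg (‖A w'‖ - ‖f.snd‖)]
  have i5 := hC w'
  nlinarith [mul_nonneg (abs_nonneg ν) (sq_nonneg ‖R w'‖), mul_nonneg hC0 (sq_nonneg ‖f.snd‖),
    sq_nonneg ‖A w'‖, sq_nonneg ‖R w'‖]

theorem boundedBelow (h : ResolventPair D H R A) (hν : |ν| < 1)
    (hB : ∀ u p, (u, p) ∈ D.graph → R p = B u) (hG : ∀ u p, (u, p) ∈ D.graph → A p = G u)
    (hT : ∀ f g, (f, g) ∈ T.graph ↔ f.fst = R g.fst + (ν : ℂ) • B f.snd ∧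
        g.snd = (ν : ℂ) • A g.fst + (f.snd + ((ν : ℂ) ^ 2) • G f.snd)) : BoundedBelow T := by
  obtain ⟨δ, hδ, c, hc0, hc⟩ := h.exists_form_lower hν hB hG hT
  refine ⟨-c, fun x => ?_⟩
  obtain ⟨p, -, hp⟩ := hc _ _ (T.mem_graph x)
  have h1 := WithLp.prod_norm_sq_eq_of_L2 (x : WithLp 2 (E × E))
  rw [h1]
  nlinarith [mul_nonneg hδ.le (sq_nonneg ‖p‖), mul_nonneg hc0 (sq_nonneg ‖x.1.snd‖)]

/-- The lower bound, applied to differences of a form-Cauchy sequence, makes the derivatives of the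
first components Cauchy; closedness of `D` identifies the limit. -/
theorem formDomain_subset [CompleteSpace E] (h : ResolventPair D H R A) (hν : |ν| < 1)
    (hB : ∀ u p, (u, p) ∈ D.graph → R p = B u) (hG : ∀ u p, (u, p) ∈ D.graph → A p = G u)
    (hT : ∀ f g, (f, g) ∈ T.graph ↔ f.fst = R g.fst + (ν : ℂ) • B f.snd ∧
        g.snd = (ν : ℂ) • A g.fst + (f.snd + ((ν : ℂ) ^ 2) • G f.snd)) :
    formDomain T ⊆ {f | f.fst ∈ D.domain} := by
  obtain ⟨δ, hδ, c, hc0, hc⟩ := h.exists_form_lower hν hB hG hT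
  rintro u ⟨x, hxu, ht⟩
  have hp : ∀ n, ∃ p, ((x n).1.fst, p) ∈ D.graph := fun n => by
    obtain ⟨p, hp, -⟩ := hc _ _ (T.mem_graph (x n))
    exact ⟨p, hp⟩
  choose p hp using hp
  have hfst : Tendsto (fun n => (x n).1.fst) atTop (𝓝 u.fst) := by
    exact ((continuous_fst.comp (WithLp.prod_continuous_ofLp 2 E E)).tendsto u).comp hxu
  have hdiff : Tendsto (fun k : ℕ × ℕ => ‖(x k.1).1.fst - (x k.2).1.fst‖ ^ 2) atTop (𝓝 0) := by
    apply tendsto_norm_sub_sq hfst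
  have hbound : ∀ k : ℕ × ℕ, ‖p k.1 - p k.2‖ ^ 2 ≤ δ⁻¹ *
      ((inner ℂ ((x k.1 - x k.2 : T.domain) : WithLp 2 (E × E)) (T (x k.1 - x k.2))).re +
        c * ‖(x k.1).1.fst - (x k.2).1.fst‖ ^ 2) := by
    intro k
    obtain ⟨s, hs, hle⟩ := hc _ _ (T.mem_graph (x k.1 - x k.2))
    have e : p k.1 - p k.2 = s :=
      D.mem_graph_snd_inj' (D.graph.sub_mem (hp k.1) (hp k.2)) hs rfl
    have e2 : ((x k.1 - x k.2 : T.domain) : WithLp 2 (E × E)).fst =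
      (x k.1).1.fst - (x k.2).1.fst := rfl
    rw [e2] at hle
    rw [e, inv_mul_eq_div, le_div_iff₀ hδ]
    linarith
  have hp0 : Tendsto (fun k : ℕ × ℕ => ‖p k.1 - p k.2‖ ^ 2) atTop (𝓝 0) := by
    have hlim := (((Complex.continuous_re.tendsto _).comp ht).add (hdiff.const_mul c)).const_mul δ⁻¹
    simp only [Complex.zero_re, mul_zero, add_zero] at hlim
    exact squeeze_zero (fun k => sq_nonneg ‖p k.1 - p k.2‖) hbound hlim
  have hcauchy : CauchySeq p := by
    rw [cauchySeq_iff_tendsto_dist_atTop_0]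
    have hs := hp0.sqrt
    simp only [Real.sqrt_zero, Real.sqrt_sq (norm_nonneg _)] at hs
    simpa only [dist_eq_norm] using hs
  obtain ⟨q, hq⟩ := cauchySeq_tendsto_of_complete hcauchy
  have : (u.fst, q) ∈ D.graph := by
    have h1 := hfst.prodMk_nhds hq
    rw [← SetLike.mem_coe]
    exact h.closed.mem_of_tendsto h1 (Eventually.of_forall hp)
  exact LinearPMap.mem_domain_of_mem_graph this

/-- The first component is approximated by `R wₙ` in the graph norm of `D`, the second by elements
of the domain of `D` in the norm of `E`. The upper bound involves neither `w` nor the derivative of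
`f₂`, so this convergence makes the sequence form-Cauchy. -/
theorem subset_formDomain (h : ResolventPair D H R A)
    (hle : (block H (-((ν : ℂ) • D)) ((ν : ℂ) • D) (one E)).graph ≤ T.graph) :
    {f | f.fst ∈ D.domain} ⊆ formDomain T := by
  obtain ⟨C, hC⟩ := h.exists_form_upper ν
  intro u hu
  obtain ⟨p, hp⟩ := LinearPMap.mem_domain_iff.1 hu
  choose w hw1 hw2 using fun n : ℕ => h.core hp (1 / ((n : ℝ) + 1)) Nat.one_div_pos_of_nat
  choose z hz hzu using fun n : ℕ =>
    Metric.mem_closure_iff.1 (h.dense u.snd) (1 / ((n : ℝ) + 1)) Nat.one_div_pos_of_nat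
  choose q hq using fun n => LinearPMap.mem_domain_iff.1 (hz n)
  have lim : ∀ {v : ℕ → E} {v₀ : E}, (∀ n, ‖v n - v₀‖ < 1 / ((n : ℝ) + 1)) →
      Tendsto v atTop (𝓝 v₀) := fun hv => by
    rw [tendsto_iff_norm_sub_tendsto_zero]
    exact squeeze_zero (fun _ => norm_nonneg _) (fun n => (hv n).le)
      tendsto_one_div_add_atTop_nhds_zero_nat
  have lR := lim hw1
  have lA := lim hw2
  have lz : Tendsto z atTop (𝓝 u.snd) := lim fun n => by
    have := hzu n
    rwa [dist_comm, dist_eq_norm] at this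
  let a : ℕ → WithLp 2 (E × E) := fun n => WithLp.toLp 2 (R (w n), z n)
  let b : ℕ → WithLp 2 (E × E) := fun n =>
    WithLp.toLp 2 (w n - (ν : ℂ) • q n, (ν : ℂ) • A (w n) + z n)
  have hab : ∀ n, (a n, b n) ∈ (block H (-((ν : ℂ) • D)) ((ν : ℂ) • D) (one E)).graph := fun n =>
    (h.mem_graph_block _ _).2 ⟨w n, q n, rfl, hq n, rfl, rfl⟩
  have hdom : ∀ n, a n ∈ T.domain := fun n => LinearPMap.mem_domain_of_mem_graph (hle (hab n))
  refine ⟨fun n => ⟨a n, hdom n⟩, ?_, ?_⟩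
  · exact ((WithLp.prod_continuous_toLp 2 E E).tendsto (u.fst, u.snd)).comp (lR.prodMk_nhds lz)
  · have hval : ∀ k : ℕ × ℕ, T (⟨a k.1, hdom k.1⟩ - ⟨a k.2, hdom k.2⟩) = b k.1 - b k.2 := by
      intro k
      exact T.mem_graph_snd_inj' (T.mem_graph _)
        (T.graph.sub_mem (hle (hab k.1)) (hle (hab k.2))) rfl
    have hlim := (((tendsto_norm_sub_sq lA).add (tendsto_norm_sub_sq lR)).add
      (tendsto_norm_sub_sq lz)).const_mul C
    rw [add_zero, add_zero, mul_zero] at hlim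
    refine squeeze_zero_norm (fun k => ?_) hlim
    rw [hval]
    have := hC _ _ (w k.1 - w k.2) (Submodule.sub_mem _ (hab k.1) (hab k.2))
      (map_sub R _ _).symm
    rwa [map_sub, map_sub] at this

end ResolventPair

end Block

end BlockOp

/-! ### The Schrödinger block operator -/

theorem lemma4p2 (m ν : ℝ) (V : ℝ → ℝ) (hm : 0 < m) (hν : |ν| < 1)
    (hV : LocallyIntegrable V volume)
    (hVcomp : Tendsto (fun x : ℝ => ∫ t in x..(x + 1), |V t|) (cocompact ℝ) (𝓝 0))
    (h0 : BlockOp.MemResolventSet (BlockOp.H m V) 0) :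
    -- the domain of `𝒜₀` is `𝒟(H_V) × W^{1,2}(ℝ)`, and `𝒜₀` is essentially self-adjoint
    (∀ f : BlockOp.L2xL2, f ∈ (BlockOp.A0 m ν V).domain ↔
      f.fst ∈ (BlockOp.H m V).domain ∧ f.snd ∈ BlockOp.W12) ∧
    BlockOp.EssentiallySelfAdjoint (BlockOp.A0 m ν V) ∧
    -- `D H_V⁻¹` is defined on all of `L²(ℝ)`, and `H_V⁻¹ D` and `S(0)`, both with domain
    -- `W^{1,2}(ℝ)`, are closable with closures defined on all of `L²(ℝ)`
    (BlockOp.DHinv m V).domain = ⊤ ∧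
    ((BlockOp.HinvD m V).domain = BlockOp.W12 ∧ (BlockOp.HinvD m V).IsClosable ∧
      (BlockOp.HinvD m V).closure.domain = ⊤) ∧
    ((BlockOp.S0 m ν V).domain = BlockOp.W12 ∧ (BlockOp.S0 m ν V).IsClosable ∧
      (BlockOp.S0 m ν V).closure.domain = ⊤) ∧
    -- the Frobenius-Schur factorization of the closure of `𝒜₀`
    (BlockOp.A0 m ν V).closure =
      BlockOp.pcomp
        (BlockOp.block (BlockOp.one BlockOp.L2) 0
          ((ν : ℂ) • BlockOp.DHinv m V) (BlockOp.one BlockOp.L2))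
        (BlockOp.pcomp
          (BlockOp.block (BlockOp.H m V) 0
            0 (BlockOp.S0 m ν V).closure)
          (BlockOp.block (BlockOp.one BlockOp.L2) (-((ν : ℂ) • (BlockOp.HinvD m V).closure))
            0 (BlockOp.one BlockOp.L2))) ∧
    -- the domain of the closure
    (∀ f : BlockOp.L2xL2, f ∈ (BlockOp.A0 m ν V).closure.domain ↔
      ∃ h : f.snd ∈ (BlockOp.HinvD m V).closure.domain,
        f.fst - (ν : ℂ) • (BlockOp.HinvD m V).closure ⟨f.snd, h⟩ ∈ (BlockOp.H m V).domain) ∧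
    -- the closure is bounded from below, and its form domain is `W^{1,2}(ℝ) × L²(ℝ)`
    BlockOp.BoundedBelow (BlockOp.A0 m ν V).closure ∧
    BlockOp.formDomain (BlockOp.A0 m ν V).closure =
      {f : BlockOp.L2xL2 | f.fst ∈ BlockOp.W12} := by

  obtain ⟨R, A, h⟩ := BlockOp.exists_resolventPair hV hVcomp h0
  obtain ⟨B, hBA, hB⟩ := h.exists_B
  obtain ⟨G, hG⟩ := h.exists_G hB
  have hGs := h.G_symm hG
  have hDH : BlockOp.DHinv m V = BlockOp.ofCLM A := h.pcomp_inverse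
  obtain ⟨hHD, hHDc⟩ : (BlockOp.HinvD m V).IsClosable ∧
    (BlockOp.HinvD m V).closure = BlockOp.ofCLM B := h.closure_inverse_pcomp hB
  obtain ⟨hS, hSc⟩ : (BlockOp.S0 m ν V).IsClosable ∧ (BlockOp.S0 m ν V).closure =
    BlockOp.ofCLM (ContinuousLinearMap.id ℂ BlockOp.L2 + ((ν : ℂ) ^ 2) • G) :=
    h.closure_schur hG ν
  -- Here `T` is the Frobenius-Schur product itself, so identifying the closure of `𝒜₀` with `T`
  -- already proves the factorization.
  have hT := fun f g => h.mem_graph_frobenius (ν := ν) (B := B) (G := G) f g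
  have hgraph := h.topologicalClosure_graph_block hB hG hT
  obtain ⟨hA, hAc⟩ := BlockOp.closure_eq_of_graph (T := BlockOp.A0 m ν V) hgraph
  rw [BlockOp.EssentiallySelfAdjoint, hAc, hDH, hHDc, hSc]
  refine ⟨fun f => ?_, ⟨hA, h.isSelfAdjoint hBA hGs hT⟩, rfl,
    ⟨h.inverse_pcomp_domain, hHD, rfl⟩, ⟨h.schur_domain ν, hS, rfl⟩, rfl, fun f => ?_,
    h.boundedBelow hν hB hG hT, ?_⟩
  · constructor
    · rintro ⟨⟨h1, -⟩, h2, -⟩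
      exact ⟨h1, h2⟩
    · rintro ⟨h1, h2⟩
      obtain ⟨w, hw⟩ := LinearPMap.mem_domain_iff.1 h1
      rw [h.graph] at hw
      -- The domain of `H_V` lies in `W^{1,2}`, so the entry `ν D` of the first column imposes no
      -- further condition.
      have h3 : f.fst ∈ BlockOp.D.domain := by
        rw [hw]
        exact LinearPMap.mem_domain_of_mem_graph (h.deriv w)
      exact ⟨⟨h1, h3⟩, h2, Submodule.mem_top⟩
  · rw [LinearPMap.mem_domain_iff]
    constructor
    · rintro ⟨g, hg⟩
      obtain ⟨h1, -⟩ := (hT f g).1 hg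
      refine ⟨Submodule.mem_top, ?_⟩
      have e : f.fst - (ν : ℂ) • B f.snd = R g.fst := by rw [h1, add_sub_cancel_right]
      change f.fst - (ν : ℂ) • B f.snd ∈ _
      rw [e]
      exact LinearPMap.mem_domain_of_mem_graph (h.mem_graph _)
    · rintro ⟨_, h1⟩
      change f.fst - (ν : ℂ) • B f.snd ∈ _ at h1
      obtain ⟨w, hw⟩ := LinearPMap.mem_domain_iff.1 h1
      rw [h.graph] at hw
      exact ⟨WithLp.toLp 2 (w, (ν : ℂ) • A w + (f.snd + ((ν : ℂ) ^ 2) • G f.snd)),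
        (hT _ _).2 ⟨sub_eq_iff_eq_add.1 hw, rfl⟩⟩
  · refine (h.formDomain_subset hν hB hG hT).antisymm (h.subset_formDomain (ν := ν) ?_)
    rw [← hgraph]
    exact Submodule.le_topologicalClosure _
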